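/- Let $f\ge1$ be an integer. There are constants $C,c>0$ depending only on $f$ such that the following holds. Consider a chain of spins $-n,-n+1,\dots,n+1$, each of local dimension $d$, with Hamiltonian $H'=\sum_{i=-n}^{n}H'_i$, where $H'_i$ is Hermitian, acts on the spins $i$ and $i+1$ only, and satisfies $0\le H'_i\le 1$. For a Hermitian operator $A$ let $\epsilon_0(A)$ be its smallest eigenvalue. Let $1\le s\le n$ and put $H'_L=\sum_{i=-n}^{-s-1}H'_i$, $H'_M=\sum_{i=1-s}^{s-1}H'_i$, $H'_R=\sum_{i=s+1}^{n}H'_i$ (empty sums are $0$), and $$H_L=H'_L-\epsilon_0(H'_L),\quad H_R=H'_R-\epsilon_0(H'_R),\quad H_{\pm s}=H'_{\pm s},\quad H_i=H'_i-\frac{\epsilon_0(H'_M)}{2s-1}\ \ (|i|<s),$$ $$H=H_L+\sum_{i=-s}^{s}H_i+H_R .$$ Suppose that the eigenvalues of $H$, counted with multiplicity, satisfy $\epsilon_0=\epsilon_1=\dots=\epsilon_{f-1}<\epsilon_f\le\epsilon_{f+1}\le\cdots$. Let $\epsilon=\epsilon_f-\epsilon_0$ be the gap and $G$ the ($f$-dimensional)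 eigenspace of $H$ for the eigenvalue $\epsilon_0$. For real $t$ let $H_L^{\le t}=H_LP_L^{\le t}+t(1-P_L^{\le t})$, where $P_L^{\le t}$ is the orthogonal projection onto the span of the eigenvectors of $H_L$ with eigenvalue at most $t$; define $H_R^{\le t}$ in the same way, and let $$H^{(t)}=H_L^{\le t}+\sum_{i=-s}^{s}H_i+H_R^{\le t}.$$ Let $\epsilon'_0\le\epsilon'_1\le\cdots$ be the eigenvalues of $H^{(t)}$, counted with multiplicity, and $\phi_0,\phi_1,\dots$ any orthonormal basis of corresponding eigenvectors. If $t\ge C\max\{1,\log\epsilon^{-1}\}$, then (a) $0\le\epsilon_0-\epsilon'_{f-1}\le\epsilon_0-\epsilon'_{f-2}\le\cdots\le\epsilon_0-\epsilon'_0\le2^{-ct}$; (b) for each $i=0,1,\dots,f-1$ there is a unit vector $\psi_i\in G$ with $\|\psi_i-\phi_i\|^2\le2^{-ct}$; (c) $\epsilon'_f-\epsilon'_0\ge\epsilon/10$. -/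

import Mathlib

noncomputable section

namespace SpinChain

/-- Configurations of the spins `-n, …, n + 1`, each with `d` basis states.
The spin at position `i` is stored at the index `i + n` of `Fin (2 * n + 1 + 1)`. -/
abbrev Config (n d : ℕ) : Type := Fin (2 * n + 1 + 1) → Fin d

/-- The Hilbert space of the chain, the `(2 n + 2)`-fold tensor power of `ℂ ^ d`,
realised as `ℓ²` of the product basis. -/
abbrev Hilb (n d : ℕ) : Type := EuclideanSpace ℂ (Config n d)

/-- Operators on the Hilbert space of the chain. -/
abbrev Op (n d : ℕ) : Type := Hilb n d →L[ℂ] Hilb n d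

/-- A choice of a two-spin matrix for each of the bonds `-n, …, n`.
The bond `i`, which joins the spins `i` and `i + 1`, is stored at the index `i + n`. -/
abbrev Interaction (n d : ℕ) : Type :=
  Fin (2 * n + 1) → Matrix (Fin d × Fin d) (Fin d × Fin d) ℂ

open scoped ComplexOrder in
/-- All the two-spin terms satisfy `0 ≤ h_i ≤ 1` as Hermitian matrices. -/
def Interaction.IsNormalized {n d : ℕ} (h : Interaction n d) : Prop :=
  ∀ k, (h k).PosSemidef ∧ (1 - h k).PosSemidef

/-- The position `i ∈ {-n, …, n}` of a bond. -/
def pos {n : ℕ} (k : Fin (2 * n + 1)) : ℤ := (k : ℤ) - (n : ℤ)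

section Operators

variable {n d : ℕ}

/-- The smallest eigenvalue `ε₀(A)` of a Hermitian operator. -/
def groundEnergy (A : Op n d) : ℝ :=
  sInf {μ : ℝ | ∃ ψ : Hilb n d, ψ ≠ 0 ∧ A ψ = (μ : ℂ) • ψ}

/-- The ground-state space of a Hermitian operator. -/
def groundSpace (A : Op n d) : Submodule ℂ (Hilb n d) :=
  Module.End.eigenspace (A : Hilb n d →ₗ[ℂ] Hilb n d) (groundEnergy A : ℂ)

/-- The span of the eigenvectors of `A` with eigenvalue at most `t`. -/
def lowEnergySpace (A : Op n d) (t : ℝ) : Submodule ℂ (Hilb n d) :=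
  Submodule.span ℂ {ψ | ∃ μ : ℝ, μ ≤ t ∧ A ψ = (μ : ℂ) • ψ}

/-- `A P + t (1 - P)`, where `P` is the orthogonal projection onto `lowEnergySpace A t`. -/
def truncate (A : Op n d) (t : ℝ) : Op n d :=
  A * (lowEnergySpace A t).starProjection + (t : ℂ) • (1 - (lowEnergySpace A t).starProjection)

/-- `E 0 ≤ E 1 ≤ …` are the eigenvalues of `A`, repeated according to multiplicity, and
`φ 0, φ 1, …` is an orthonormal basis of corresponding eigenvectors. -/
def IsEigensystem {N : ℕ} (A : Op n d) (E : Fin N → ℝ)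
    (φ : OrthonormalBasis (Fin N) ℂ (Hilb n d)) : Prop :=
  Monotone E ∧ ∀ i, A (φ i) = (E i : ℂ) • φ i

end Operators

section Hamiltonian

variable {n d : ℕ} (h : Interaction n d)

/-- The original term `H'_i`: the two-spin matrix of the bond acting on the spins `i`, `i + 1`
and as the identity on all the other spins. -/
def bondTerm (k : Fin (2 * n + 1)) : Op n d :=
  Matrix.toEuclideanCLM (n := Config n d) (𝕜 := ℂ) (Matrix.of fun σ τ : Config n d =>
    if ∀ j, j ≠ k.castSucc → j ≠ k.succ → σ j = τ j then
      h k (σ k.castSucc, σ k.succ) (τ k.castSucc, τ k.succ)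
    else 0)

/-- `H'_L`, the sum of the `H'_i` with `-n ≤ i ≤ -s - 1`. -/
def leftBare (s : ℕ) : Op n d := ∑ k with pos k < -(s : ℤ), bondTerm h k

/-- `H'_M`, the sum of the `H'_i` with `1 - s ≤ i ≤ s - 1`. -/
def middleBare (s : ℕ) : Op n d := ∑ k with |pos k| < (s : ℤ), bondTerm h k

/-- `H'_R`, the sum of the `H'_i` with `s + 1 ≤ i ≤ n`. -/
def rightBare (s : ℕ) : Op n d := ∑ k with (s : ℤ) < pos k, bondTerm h k

/-- `H_L = H'_L - ε₀(H'_L)`. -/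
def leftPart (s : ℕ) : Op n d := leftBare h s - (groundEnergy (leftBare h s) : ℂ) • 1

/-- `H_R = H'_R - ε₀(H'_R)`. -/
def rightPart (s : ℕ) : Op n d := rightBare h s - (groundEnergy (rightBare h s) : ℂ) • 1

/-- The terms `H_i` with `-s ≤ i ≤ s`: `H'_i` for `i = ± s`, and
`H'_i - ε₀(H'_M) / (2 s - 1)` for `|i| < s`. -/
def centralTerm (s : ℕ) (k : Fin (2 * n + 1)) : Op n d :=
  if |pos k| = (s : ℤ) then bondTerm h k
  else bondTerm h k - ((groundEnergy (middleBare h s) / (2 * (s : ℝ) - 1) : ℝ) : ℂ) • 1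

/-- `H_{-s} + H_{1-s} + ⋯ + H_s`. -/
def centralPart (s : ℕ) : Op n d := ∑ k with |pos k| ≤ (s : ℤ), centralTerm h s k

/-- The Hamiltonian `H = H_L + H_{-s} + ⋯ + H_s + H_R`. -/
def hamiltonian (s : ℕ) : Op n d := leftPart h s + centralPart h s + rightPart h s

/-- The truncated Hamiltonian `H^(t)`, in which `H_L` and `H_R` are cut off at energy `t`. -/
def truncatedHamiltonian (s : ℕ) (t : ℝ) : Op n d :=
  truncate (leftPart h s) t + centralPart h s + truncate (rightPart h s) t

end Hamiltonian

end SpinChain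

end

/-! Truncation only lowers the Hamiltonian, so min-max gives `E' i ≤ E i`. Everything else follows
from a converse on the span of the first `f + 1` eigenvectors of H^(t): there H exceeds H^(t) by at
most η = K exp(-t/2), with K depending only on f. Min-max then gives (a) and (c). For (b), a vector
with energy excess at most η has weight at most η/ε outside the ground space, and t ≥ C log(1/ε)
makes η/ε exponentially small.

The converse is an exponential tail bound (`norm_exp_apply_sq_le`). Write H^(t) = min(A, t) + W + B,
where A is H_L (or H_R), B is the one cut bond touching it, and W ≥ 0 commutes with A. If φ is an
eigenvector of energy E and u = exp(A/4) φ, conjugating the eigenvalue equation changes only B, into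
an operator of norm at most 2. Hence u has mean truncated energy at most E + 2, so its weight cannot
sit mostly above a level τ ≥ E + 3; below τ, u is comparable to φ. Thus exp(A/4) φ is bounded
independently of the chain, and the energy cut off above t costs a factor exp(-t/2)
(`re_inner_sub_truncate_le`).

The conjugated bond is bounded by locality (`norm_exp_conj_le`): the m-th commutator of B with A/4
spreads by one bond per step, so its norm is at most m!/2^m, and the exponential series becomes
geometric.

The level τ must depend on f alone. This follows from ε₀ ≤ 2, by a product of ground states of the
three decoupled parts (`groundEnergy_le_two`), and ε_f ≤ ε₀ + f + 1, by freeing f + 1 spins at the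
end of the chain (`excitation_le`). -/

noncomputable section

namespace SpinChain

/-! ### Matrices supported on a set of sites -/

section Local

variable {ι κ : Type*} [Fintype ι] [DecidableEq ι] [Fintype κ]

/-- A matrix indexed by configurations acts only on the sites in `S`: it is diagonal in the other
sites, and its entries do not depend on the configuration there. -/
structure IsLocal (S : Set ι) (M : Matrix (ι → κ) (ι → κ) ℂ) : Prop where
  eq_zero : ∀ σ τ j, j ∉ S → σ j ≠ τ j → M σ τ = 0
  congr : ∀ σ τ σ' τ', (∀ j ∈ S, σ j = σ' j) → (∀ j ∈ S, τ j = τ' j) →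
    (∀ j ∉ S, σ j = τ j) → (∀ j ∉ S, σ' j = τ' j) → M σ τ = M σ' τ'

/-- The first factor can change only the sites in S and the second only those in S', so a single
intermediate configuration survives in the matrix product. -/
lemma IsLocal.mul_apply {S : Set ι} {M M' : Matrix (ι → κ) (ι → κ) ℂ}
    {S' : Set ι} (hM : IsLocal S M) (hM' : IsLocal S' M') (hS : Disjoint S S')
    (σ τ ρ : ι → κ) (hρ : ∀ j ∈ S, ρ j = τ j) (hρ' : ∀ j ∉ S, ρ j = σ j) :
    (M * M') σ τ = M σ ρ * M' ρ τ := by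
  rw [Matrix.mul_apply]
  refine Finset.sum_eq_single ρ (fun ρ' _ hne => ?_) (by simp)
  obtain ⟨j, hj⟩ := Function.ne_iff.1 hne
  by_cases hjS : j ∈ S
  · rw [hM'.eq_zero ρ' τ j (fun h => Set.disjoint_left.1 hS hjS h) (by rwa [← hρ j hjS]), mul_zero]
  · rw [hM.eq_zero σ ρ' j hjS (by rw [← hρ' j hjS]; exact hj.symm), zero_mul]

/-- Matrices acting on disjoint sets of sites commute. -/
lemma IsLocal.commute {S S' : Set ι} {M M' : Matrix (ι → κ) (ι → κ) ℂ}
    (hM : IsLocal S M) (hM' : IsLocal S' M') (hS : Disjoint S S') : Commute M M' := by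
  classical
  ext σ τ
  rw [hM.mul_apply hM' hS σ τ (fun j => if j ∈ S then τ j else σ j) (by grind) (by grind),
    hM'.mul_apply hM hS.symm σ τ (fun j => if j ∈ S' then τ j else σ j) (by grind) (by grind)]
  have hd : ∀ j, j ∈ S → j ∉ S' := fun j h h' => Set.disjoint_left.1 hS h h'
  by_cases hoff : ∃ j, j ∉ S ∧ j ∉ S' ∧ σ j ≠ τ j
  · obtain ⟨j, h1, h2, h3⟩ := hoff
    rw [hM'.eq_zero _ τ j h2 (by simp [h1, h3]), hM.eq_zero _ τ j h1 (by simp [h2, h3])]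
    simp
  · push Not at hoff
    rw [mul_comm]
    congr 1
    · apply hM'.congr <;> grind
    · apply hM.congr <;> grind

end Local

/-! ### Two-spin terms: positivity, norm and commutation -/

section Bond

variable {n d : ℕ}

/-- The embedding of a two-spin matrix as an operator on the bond `k`. -/
def pairMatrix (k : Fin (2 * n + 1)) (a : Matrix (Fin d × Fin d) (Fin d × Fin d) ℂ) :
    Matrix (Config n d) (Config n d) ℂ :=
  Matrix.of fun σ τ =>
    if ∀ j, j ≠ k.castSucc → j ≠ k.succ → σ j = τ j then
      a (σ k.castSucc, σ k.succ) (τ k.castSucc, τ k.succ)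
    else 0

lemma castSucc_ne_succ (k : Fin (2 * n + 1)) : k.castSucc ≠ k.succ := by
  simp [Fin.ext_iff]

lemma isLocal_pairMatrix (k : Fin (2 * n + 1)) (a : Matrix (Fin d × Fin d) (Fin d × Fin d) ℂ) :
    IsLocal {k.castSucc, k.succ} (pairMatrix k a) where
  eq_zero σ τ j hj h := by
    simp only [pairMatrix, Matrix.of_apply]
    rw [if_neg]
    intro hall
    simp only [Set.mem_insert_iff, Set.mem_singleton_iff, not_or] at hj
    exact h (hall j hj.1 hj.2)
  congr σ τ σ' τ' h1 h2 h3 h4 := by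
    simp only [Set.mem_insert_iff, Set.mem_singleton_iff, not_or] at h1 h2 h3 h4
    simp only [pairMatrix, Matrix.of_apply]
    rw [if_pos (fun j hj hj' => h3 j ⟨hj, hj'⟩), if_pos (fun j hj hj' => h4 j ⟨hj, hj'⟩),
      h1 _ (.inl rfl), h1 _ (.inr rfl), h2 _ (.inl rfl), h2 _ (.inr rfl)]

lemma pairMatrix_conjTranspose (k : Fin (2 * n + 1))
    (a : Matrix (Fin d × Fin d) (Fin d × Fin d) ℂ) :
    (pairMatrix k a).conjTranspose = pairMatrix k a.conjTranspose := by
  ext σ τ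
  simp only [pairMatrix, Matrix.conjTranspose_apply, Matrix.of_apply, apply_ite star, star_zero,
    eq_comm (a := τ _)]

lemma pairMatrix_mul (k : Fin (2 * n + 1))
    (a b : Matrix (Fin d × Fin d) (Fin d × Fin d) ℂ) :
    pairMatrix k a * pairMatrix k b = pairMatrix k (a * b) := by
  have hk := castSucc_ne_succ k
  ext σ τ
  rw [Matrix.mul_apply]
  let e : Fin d × Fin d → Config n d := fun p =>
    Function.update (Function.update σ k.castSucc p.1) k.succ p.2
  have e1 : ∀ p, e p k.castSucc = p.1 := fun p => by simp [e, hk]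
  have e2 : ∀ p, e p k.succ = p.2 := fun p => by simp [e]
  have e3 : ∀ p j, j ≠ k.castSucc → j ≠ k.succ → e p j = σ j := fun p j h h' => by simp [e, h, h']
  have he : Function.Injective e := fun p q h => by
    ext1
    · rw [← e1 p, h, e1]
    · rw [← e2 p, h, e2]
  symm
  rw [← Fintype.sum_of_injective e he
    (fun p => pairMatrix k a σ (e p) * pairMatrix k b (e p) τ) _ _ (fun _ => rfl)]
  · by_cases hoff : ∀ j, j ≠ k.castSucc → j ≠ k.succ → σ j = τ j
    · have h1 : ∀ p, pairMatrix k a σ (e p) = a (σ k.castSucc, σ k.succ) p := fun p => by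
        simp only [pairMatrix, Matrix.of_apply, e1, e2]
        rw [if_pos fun j h h' => (e3 p j h h').symm]
      have h2 : ∀ p, pairMatrix k b (e p) τ = b p (τ k.castSucc, τ k.succ) := fun p => by
        simp only [pairMatrix, Matrix.of_apply, e1, e2]
        rw [if_pos fun j h h' => (e3 p j h h').trans (hoff j h h')]
      simp only [h1, h2]
      simp only [pairMatrix, Matrix.of_apply]
      rw [if_pos hoff, Matrix.mul_apply]
    · have h2 : ∀ p, pairMatrix k b (e p) τ = 0 := fun p => by
        simp only [pairMatrix, Matrix.of_apply]
        rw [if_neg fun h => hoff fun j hj hj' => (e3 p j hj hj').symm.trans (h j hj hj')]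
      simp only [h2, mul_zero, Finset.sum_const_zero]
      simp only [pairMatrix, Matrix.of_apply]
      rw [if_neg hoff]
  · intro ρ hρ
    simp only [pairMatrix, Matrix.of_apply]
    rw [if_neg, zero_mul]
    intro hall
    refine hρ ⟨(ρ k.castSucc, ρ k.succ), ?_⟩
    funext j
    by_cases h : j = k.castSucc
    · subst h; rw [e1]
    by_cases h' : j = k.succ
    · subst h'; rw [e2]
    rw [e3 _ _ h h', hall j h h']

lemma pairMatrix_one (k : Fin (2 * n + 1)) :
    pairMatrix k (1 : Matrix (Fin d × Fin d) (Fin d × Fin d) ℂ) = 1 := by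
  ext σ τ
  simp only [pairMatrix, Matrix.of_apply, Matrix.one_apply, Prod.mk.injEq]
  by_cases h : σ = τ
  · simp [h]
  · rw [if_neg h]
    split_ifs with h1 h2
    · refine absurd (funext fun j => ?_) h
      by_cases hj : j = k.castSucc
      · subst hj; exact h2.1
      by_cases hj' : j = k.succ
      · subst hj'; exact h2.2
      exact h1 j hj hj'
    · rfl
    · rfl

lemma pairMatrix_sub (k : Fin (2 * n + 1)) (a b : Matrix (Fin d × Fin d) (Fin d × Fin d) ℂ) :
    pairMatrix k (a - b) = pairMatrix k a - pairMatrix k b := by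
  ext σ τ
  simp only [pairMatrix, Matrix.of_apply, Matrix.sub_apply]
  split_ifs <;> simp

/-- The operator of a matrix in the product basis. -/
abbrev toOp (M : Matrix (Config n d) (Config n d) ℂ) : Op n d :=
  Matrix.toEuclideanCLM (n := Config n d) (𝕜 := ℂ) M

-- The embedding is a *-homomorphism, so it sends b* b to an operator of the same form.
open scoped ComplexOrder MatrixOrder in
lemma isPositive_toOp_pairMatrix (k : Fin (2 * n + 1))
    {a : Matrix (Fin d × Fin d) (Fin d × Fin d) ℂ} (ha : a.PosSemidef) :
    (toOp (pairMatrix k a)).IsPositive := by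
  obtain ⟨b, rfl⟩ := CStarAlgebra.nonneg_iff_eq_star_mul_self.1 ha.nonneg
  rw [← pairMatrix_mul, Matrix.star_eq_conjTranspose, ← pairMatrix_conjTranspose,
    ← Matrix.star_eq_conjTranspose, toOp, map_mul, map_star]
  exact ContinuousLinearMap.isPositive_adjoint_comp_self _

lemma isPositive_bondTerm {h : Interaction n d} (hh : h.IsNormalized) (k : Fin (2 * n + 1)) :
    (bondTerm h k).IsPositive :=
  isPositive_toOp_pairMatrix k (hh k).1

lemma isPositive_one_sub_bondTerm {h : Interaction n d} (hh : h.IsNormalized)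
    (k : Fin (2 * n + 1)) : (1 - bondTerm h k).IsPositive := by
  have := isPositive_toOp_pairMatrix k (hh k).2
  rwa [pairMatrix_sub, pairMatrix_one, toOp, map_sub, map_one] at this

lemma norm_bondTerm_le_one {h : Interaction n d} (hh : h.IsNormalized) (k : Fin (2 * n + 1)) :
    ‖bondTerm h k‖ ≤ 1 :=
  (CStarAlgebra.norm_le_one_iff_of_nonneg _
    ((ContinuousLinearMap.nonneg_iff_isPositive _).2 (isPositive_bondTerm hh k))).2
    (isPositive_one_sub_bondTerm hh k)

/-- Operators acting on disjoint sets of sites commute. -/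
lemma commute_toOp {S S' : Set (Fin (2 * n + 1 + 1))} {M M' : Matrix (Config n d) (Config n d) ℂ}
    (hM : IsLocal S M) (hM' : IsLocal S' M') (hS : Disjoint S S') : Commute (toOp M) (toOp M') :=
  (hM.commute hM' hS).map (Matrix.toEuclideanCLM (n := Config n d) (𝕜 := ℂ))

lemma commute_toOp_bondTerm {h : Interaction n d} {S : Set (Fin (2 * n + 1 + 1))}
    {M : Matrix (Config n d) (Config n d) ℂ} (hM : IsLocal S M) {k : Fin (2 * n + 1)}
    (hk : k.castSucc ∉ S) (hk' : k.succ ∉ S) : Commute (toOp M) (bondTerm h k) :=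
  commute_toOp hM (isLocal_pairMatrix k (h k)) (by simp [hk, hk'])

lemma commute_bondTerm (h : Interaction n d) {k l : Fin (2 * n + 1)} (hkl : pos k + 1 < pos l) :
    Commute (bondTerm h k) (bondTerm h l) := by
  refine commute_toOp_bondTerm (isLocal_pairMatrix k (h k)) ?_ ?_ <;>
  · simp only [pos] at hkl
    simp only [Set.mem_insert_iff, Set.mem_singleton_iff, Fin.ext_iff, Fin.val_castSucc,
      Fin.val_succ]
    omega

end Bond

/-! ### Locality bound for conjugation by an exponential -/

section Conjugation

variable {𝔸 : Type*} [NormedRing 𝔸] [NormedAlgebra ℂ 𝔸]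

/-- The commutator `X ↦ A X - X A` as a continuous linear map. -/
def commutatorCLM (A : 𝔸) : 𝔸 →L[ℂ] 𝔸 :=
  ContinuousLinearMap.mul ℂ 𝔸 A - (ContinuousLinearMap.mul ℂ 𝔸).flip A

@[simp] lemma commutatorCLM_apply (A X : 𝔸) : commutatorCLM A X = A * X - X * A := rfl

/-- Iterated commutators with a sum of terms of which only neighbours fail to commute. -/
lemma commutator_pow_bound {κ : Type*} (S : Finset κ) (b : κ → 𝔸) (δ : κ → ℕ)
    (hδ : Set.InjOn δ S) (hpos : ∀ k ∈ S, 1 ≤ δ k) (hb : ∀ k ∈ S, ‖b k‖ ≤ 1 / 4)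
    (hbb : ∀ k ∈ S, ∀ l ∈ S, δ k + 1 < δ l → Commute (b k) (b l))
    (B : 𝔸) (hB : ∀ l ∈ S, 1 < δ l → Commute B (b l)) (A : 𝔸) (z : ℂ)
    (hA : A = ∑ k ∈ S, b k - z • 1) (m : ℕ) :
    (∀ l ∈ S, m + 1 < δ l → Commute ((commutatorCLM A ^ m) B) (b l)) ∧
      ‖(commutatorCLM A ^ m) B‖ ≤ (1 / 2) ^ m * m.factorial * ‖B‖ := by
  induction m with
  | zero => simpa using hB
  | succ m ih =>
    set X := (commutatorCLM A ^ m) B with hX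
    -- The m-th commutator commutes with every term at distance beyond m + 1, so at most m + 1 terms
    -- remain. Each contributes a factor at most 2 · 1/4, which produces (m + 1)!/2^(m + 1). The
    -- scalar z drops out.
    have hstep : (commutatorCLM A ^ (m + 1)) B =
        ∑ k ∈ S with δ k ≤ m + 1, (b k * X - X * b k) := by
      rw [pow_succ', mul_apply_eq_comp, ← hX, commutatorCLM_apply, hA,
        Finset.sum_filter_of_ne]
      · simp [sub_mul, mul_sub, Finset.sum_mul, Finset.mul_sum]
      · intro k hk hne
        by_contra hlt
        exact hne (sub_eq_zero.2 (ih.1 k hk (not_le.1 hlt)).eq.symm)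
    rw [hstep]
    constructor
    · intro l hl hlt
      refine Commute.sum_left _ _ _ fun k hk => ?_
      rw [Finset.mem_filter] at hk
      have h1 : Commute (b k) (b l) := hbb k hk.1 l hl (by omega)
      have h2 := ih.1 l hl (by omega)
      exact (h1.mul_left h2).sub_left (h2.mul_left h1)
    · have hcard : (S.filter fun k => δ k ≤ m + 1).card ≤ m + 1 := by
        have := Finset.card_le_card_of_injOn (s := S.filter fun k => δ k ≤ m + 1)
          (t := Finset.Icc 1 (m + 1)) δ (fun k hk => by
            simp only [Finset.coe_filter, Set.mem_ofPred_eq] at hk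
            simpa using ⟨hpos k hk.1, hk.2⟩)
          (fun k hk l hl h => hδ (Finset.mem_filter.1 hk).1 (Finset.mem_filter.1 hl).1 h)
        simpa using this
      have hterm : ∀ k ∈ S.filter fun k => δ k ≤ m + 1,
          ‖b k * X - X * b k‖ ≤ 1 / 2 * ‖X‖ := fun k hk => by
        have hk' := hb k (Finset.mem_filter.1 hk).1
        have h1 := norm_mul_le (b k) X
        have h2 := norm_mul_le X (b k)
        have h3 := norm_sub_le (b k * X) (X * b k)
        nlinarith [norm_nonneg X]
      refine (norm_sum_le_of_le _ hterm).trans ?_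
      rw [Finset.sum_const, nsmul_eq_mul]
      have h4 : ((S.filter fun k => δ k ≤ m + 1).card : ℝ) ≤ (m : ℝ) + 1 := by exact_mod_cast hcard
      calc _ ≤ ((m : ℝ) + 1) * (1 / 2 * ((1 / 2) ^ m * m.factorial * ‖B‖)) := by
            gcongr
            exact ih.2
        _ = _ := by rw [Nat.factorial_succ]; push_cast; ring

variable [CompleteSpace 𝔸]

lemma exp_mul_apply (A X : 𝔸) :
    NormedSpace.exp (ContinuousLinearMap.mul ℂ 𝔸 A) X = NormedSpace.exp A * X := by
  have h1 := (NormedSpace.exp_series_hasSum_exp' (𝕂 := ℂ) (ContinuousLinearMap.mul ℂ 𝔸 A)).mapL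
    (ContinuousLinearMap.apply ℂ 𝔸 X)
  have h2 := (NormedSpace.exp_series_hasSum_exp' (𝕂 := ℂ) A).mul_right X
  refine h1.unique (h2.congr_fun fun k => ?_)
  have : ∀ k : ℕ, (ContinuousLinearMap.mul ℂ 𝔸 A ^ k) X = A ^ k * X := by
    intro k
    induction k with
    | zero => simp
    | succ k ih => rw [pow_succ', mul_apply_eq_comp, ih]; simp [pow_succ', mul_assoc]
  simp [this]

lemma exp_flip_mul_apply (A X : 𝔸) :
    NormedSpace.exp ((ContinuousLinearMap.mul ℂ 𝔸).flip A) X = X * NormedSpace.exp A := by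
  have h1 := (NormedSpace.exp_series_hasSum_exp' (𝕂 := ℂ)
    ((ContinuousLinearMap.mul ℂ 𝔸).flip A)).mapL (ContinuousLinearMap.apply ℂ 𝔸 X)
  have h2 := (NormedSpace.exp_series_hasSum_exp' (𝕂 := ℂ) A).mul_left X
  refine h1.unique (h2.congr_fun fun k => ?_)
  have : ∀ k : ℕ, ((ContinuousLinearMap.mul ℂ 𝔸).flip A ^ k) X = X * A ^ k := by
    intro k
    induction k with
    | zero => simp
    | succ k ih => rw [pow_succ', mul_apply_eq_comp, ih]; simp [pow_succ, mul_assoc]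
  simp [this]

lemma exp_neg_mul_exp (A : 𝔸) : NormedSpace.exp (-A) * NormedSpace.exp A = 1 := by
  let : NormedAlgebra ℚ 𝔸 := NormedAlgebra.restrictScalars ℚ ℂ _
  rw [← NormedSpace.exp_add_of_commute (Commute.refl A).neg_left, neg_add_cancel,
    NormedSpace.exp_zero]

/-- Conjugation by `exp A` is the exponential of the commutator with `A`. -/
lemma exp_commutatorCLM_apply (A X : 𝔸) :
    NormedSpace.exp (commutatorCLM A) X = NormedSpace.exp A * X * NormedSpace.exp (-A) := by
  have hc : Commute (ContinuousLinearMap.mul ℂ 𝔸 A) ((ContinuousLinearMap.mul ℂ 𝔸).flip (-A)) := by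
    ext X
    simp [mul_assoc]
  have h : commutatorCLM A =
      ContinuousLinearMap.mul ℂ 𝔸 A + (ContinuousLinearMap.mul ℂ 𝔸).flip (-A) := by
    ext X
    simp [sub_eq_add_neg]
  let : NormedAlgebra ℚ (𝔸 →L[ℂ] 𝔸) := NormedAlgebra.restrictScalars ℚ ℂ _
  rw [h, NormedSpace.exp_add_of_commute hc, mul_apply_eq_comp, exp_mul_apply,
    exp_flip_mul_apply, mul_assoc]

/-- Conjugation of a boundary term by the exponential of a chain Hamiltonian is bounded uniformly
in the length of the chain. -/
lemma norm_exp_conj_le {κ : Type*} (S : Finset κ) (b : κ → 𝔸) (δ : κ → ℕ)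
    (hδ : Set.InjOn δ S) (hpos : ∀ k ∈ S, 1 ≤ δ k) (hb : ∀ k ∈ S, ‖b k‖ ≤ 1 / 4)
    (hbb : ∀ k ∈ S, ∀ l ∈ S, δ k + 1 < δ l → Commute (b k) (b l))
    (B : 𝔸) (hB : ∀ l ∈ S, 1 < δ l → Commute B (b l)) (A : 𝔸) (z : ℂ)
    (hA : A = ∑ k ∈ S, b k - z • 1) :
    ‖NormedSpace.exp A * B * NormedSpace.exp (-A)‖ ≤ 2 * ‖B‖ := by
  rw [← exp_commutatorCLM_apply]
  have h1 := (NormedSpace.exp_series_hasSum_exp' (𝕂 := ℂ) (commutatorCLM A)).mapL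
    (ContinuousLinearMap.apply ℂ 𝔸 B)
  -- The 1/m! of the exponential series cancels the factorial growth of the commutators.
  have h2 : HasSum (fun m : ℕ => (1 / 2 : ℝ) ^ m * ‖B‖) (2 * ‖B‖) :=
    hasSum_geometric_two.mul_right _
  refine h1.norm_le_of_bounded h2 fun m => ?_
  have h3 := (commutator_pow_bound S b δ hδ hpos hb hbb B hB A z hA m).2
  have h4 : (0 : ℝ) < m.factorial := by exact_mod_cast m.factorial_pos
  simp only [ContinuousLinearMap.apply_apply, smul_apply, norm_smul, norm_inv,
    RCLike.norm_natCast]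
  rw [inv_mul_le_iff₀ h4]
  linarith

end Conjugation

/-! ### Eigenbases and variational bounds -/

section Diagonal

variable {ι V : Type*} [Fintype ι] [NormedAddCommGroup V] [InnerProductSpace ℂ V]

lemma inner_apply_of_diagonal (b : OrthonormalBasis ι ℂ V) {A : V →L[ℂ] V} {a : ι → ℝ}
    (h : ∀ i, A (b i) = (a i : ℂ) • b i) (i : ι) (v : V) :
    inner ℂ (b i) (A v) = (a i : ℂ) * inner ℂ (b i) v := by
  classical
  conv_lhs => rw [← b.sum_repr' v]
  simp only [map_sum, map_smul, h, inner_sum, inner_smul_right, b.inner_eq_ite]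
  simp [mul_comm]

lemma re_inner_apply_of_diagonal (b : OrthonormalBasis ι ℂ V) {A : V →L[ℂ] V} {a : ι → ℝ}
    (h : ∀ i, A (b i) = (a i : ℂ) • b i) (v : V) :
    (inner ℂ v (A v)).re = ∑ i, a i * ‖inner ℂ (b i) v‖ ^ 2 := by
  rw [← b.sum_inner_mul_inner v (A v), Complex.re_sum]
  refine Finset.sum_congr rfl fun i _ => ?_
  rw [inner_apply_of_diagonal b h, ← inner_conj_symm v (b i), mul_left_comm,
    ← Complex.normSq_eq_conj_mul_self, Complex.normSq_eq_norm_sq, ← Complex.ofReal_mul,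
    Complex.ofReal_re]

end Diagonal

section Eigensystem

variable {n d : ℕ}

/-- The variational bound on the `i`-th eigenvalue given by a subspace of dimension `> i`. -/
lemma IsEigensystem.le_of_forall_mem {N : ℕ} {A : Op n d} {E : Fin N → ℝ}
    {φ : OrthonormalBasis (Fin N) ℂ (Hilb n d)} (h : IsEigensystem A E φ) (i : Fin N)
    (U : Submodule ℂ (Hilb n d)) (hU : (i : ℕ) < Module.finrank ℂ U) (c : ℝ)
    (hc : ∀ v ∈ U, (inner ℂ v (A v)).re ≤ c * ‖v‖ ^ 2) : E i ≤ c := by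
  -- The first i coordinates cannot be injective on U, so U contains a nonzero vector orthogonal to
  -- them; its energy is at least `E i`.
  let L : U →ₗ[ℂ] (Fin i → ℂ) :=
    LinearMap.pi fun j => ((innerSL ℂ (φ ⟨j, by omega⟩)).toLinearMap).comp U.subtype
  have hker : LinearMap.ker L ≠ ⊥ := LinearMap.ker_ne_bot_of_finrank_lt (by simpa using hU)
  obtain ⟨v, hv, hv0⟩ := (Submodule.ne_bot_iff _).1 hker
  have hv1 : ∀ j : Fin N, j < i → inner ℂ (φ j) (v : Hilb n d) = 0 := fun j hj => by
    have := congrFun (LinearMap.mem_ker.1 hv) ⟨j, hj⟩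
    simpa [L] using this
  have hvpos : 0 < ‖(v : Hilb n d)‖ ^ 2 := by
    have : (v : Hilb n d) ≠ 0 := by simpa using hv0
    positivity
  have h1 : E i * ‖(v : Hilb n d)‖ ^ 2 ≤ (inner ℂ (v : Hilb n d) (A v)).re := by
    rw [re_inner_apply_of_diagonal φ h.2, ← φ.sum_sq_norm_inner_right, Finset.mul_sum]
    refine Finset.sum_le_sum fun j _ => ?_
    by_cases hj : j < i
    · simp [hv1 j hj]
    · exact mul_le_mul_of_nonneg_right (h.1 (not_lt.1 hj)) (by positivity)
  exact le_of_mul_le_mul_right (h1.trans (hc v v.2)) hvpos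

lemma IsEigensystem.le_re_inner {N : ℕ} {A : Op n d} {E : Fin N → ℝ}
    {φ : OrthonormalBasis (Fin N) ℂ (Hilb n d)} (h : IsEigensystem A E φ) (hN : 0 < N)
    (v : Hilb n d) : E ⟨0, hN⟩ * ‖v‖ ^ 2 ≤ (inner ℂ v (A v)).re := by
  rw [re_inner_apply_of_diagonal φ h.2, ← φ.sum_sq_norm_inner_right, Finset.mul_sum]
  exact Finset.sum_le_sum fun j _ =>
    mul_le_mul_of_nonneg_right (h.1 (Fin.mk_le_of_le_val (Nat.zero_le _))) (by positivity)

lemma re_inner_of_eigen {A : Op n d} {μ : ℝ} {v : Hilb n d} (h : A v = (μ : ℂ) • v) :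
    (inner ℂ v (A v)).re = μ * ‖v‖ ^ 2 := by
  rw [h, inner_smul_right, Complex.re_ofReal_mul]
  exact congrArg (μ * ·) (inner_self_eq_norm_sq (𝕜 := ℂ) v)

lemma IsEigensystem.groundEnergy_eq {N : ℕ} {A : Op n d} {E : Fin N → ℝ}
    {φ : OrthonormalBasis (Fin N) ℂ (Hilb n d)} (h : IsEigensystem A E φ) (hN : 0 < N) :
    groundEnergy A = E ⟨0, hN⟩ := by
  refine IsLeast.csInf_eq ⟨⟨φ ⟨0, hN⟩, ?_, h.2 _⟩, ?_⟩
  · simpa using φ.toBasis.ne_zero ⟨0, hN⟩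
  · rintro μ ⟨v, hv, hμ⟩
    have h1 := h.le_re_inner hN v
    rw [re_inner_of_eigen hμ] at h1
    have : 0 < ‖v‖ ^ 2 := by positivity
    exact le_of_mul_le_mul_right h1 this

lemma exists_isEigensystem {A : Op n d} (hA : IsSelfAdjoint A) :
    ∃ (E : Fin (Module.finrank ℂ (Hilb n d)) → ℝ)
      (φ : OrthonormalBasis (Fin (Module.finrank ℂ (Hilb n d))) ℂ (Hilb n d)),
      IsEigensystem A E φ := by
  have hs : (A : Hilb n d →ₗ[ℂ] Hilb n d).IsSymmetric := hA.isSymmetric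
  refine ⟨hs.eigenvalues rfl ∘ Fin.rev, (hs.eigenvectorBasis rfl).reindex Fin.revPerm, ?_, ?_⟩
  · intro i j hij
    exact hs.eigenvalues_antitone rfl (Fin.rev_le_rev.2 hij)
  · intro i
    rw [OrthonormalBasis.reindex_apply]
    exact hs.apply_eigenvectorBasis rfl (Fin.rev i)

lemma exists_ground [Nontrivial (Hilb n d)] {A : Op n d} (hA : IsSelfAdjoint A) :
    (∃ ξ : Hilb n d, ξ ≠ 0 ∧ A ξ = (groundEnergy A : ℂ) • ξ) ∧
      ∀ v, groundEnergy A * ‖v‖ ^ 2 ≤ (inner ℂ v (A v)).re := by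
  obtain ⟨E, φ, h⟩ := exists_isEigensystem hA
  have hN : 0 < Module.finrank ℂ (Hilb n d) := Module.finrank_pos
  rw [h.groundEnergy_eq hN]
  exact ⟨⟨φ ⟨0, hN⟩, by simpa using φ.toBasis.ne_zero ⟨0, hN⟩, h.2 _⟩, h.le_re_inner hN⟩

end Eigensystem

/-! ### Energy truncation and the exponential tail bound -/

section Truncate

variable {n d : ℕ}

/-- Eigenvectors above t are orthogonal to all those below, so the projection kills them. Truncation
is therefore min(·, t) in any eigenbasis of A. -/
lemma truncate_apply_eigen {A : Op n d} (hA : IsSelfAdjoint A) (t : ℝ) {μ : ℝ} {v : Hilb n d}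
    (h : A v = (μ : ℂ) • v) : truncate A t v = ((min μ t : ℝ) : ℂ) • v := by
  have hs : (A : Hilb n d →ₗ[ℂ] Hilb n d).IsSymmetric := hA.isSymmetric
  rcases le_or_gt μ t with hle | hlt
  · have hP : (lowEnergySpace A t).starProjection v = v :=
      Submodule.starProjection_eq_self_iff.2 (Submodule.subset_span ⟨μ, hle, h⟩)
    simp [truncate, hP, h, hle]
  · have hP : (lowEnergySpace A t).starProjection v = 0 := by
      rw [Submodule.starProjection_apply_eq_zero_iff, Submodule.mem_orthogonal]
      intro u hu
      induction hu using Submodule.span_induction with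
      | mem u hu =>
        obtain ⟨ν, hν, hu⟩ := hu
        have h1 := hs u v
        simp only [ContinuousLinearMap.coe_coe, hu, h, inner_smul_left, inner_smul_right,
          Complex.conj_ofReal] at h1
        have h2 : ((ν : ℂ) - μ) * inner ℂ u v = 0 := by rw [sub_mul, h1, sub_self]
        refine (mul_eq_zero.1 h2).resolve_left fun h3 => ?_
        rw [sub_eq_zero] at h3
        have := Complex.ofReal_injective h3
        linarith
      | zero => simp
      | add x y _ _ hx hy => rw [inner_add_left, hx, hy, add_zero]
      | smul a x _ hx => rw [inner_smul_left, hx, mul_zero]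
    simp [truncate, hP, hlt.le]

/-- C preserves each eigenspace of A, hence the low-energy space; being self-adjoint it preserves
the orthogonal complement too, so it commutes with the projection. -/
lemma Commute.truncate_left {A C : Op n d} (hAC : Commute A C) (hC : IsSelfAdjoint C) (t : ℝ) :
    Commute (truncate A t) C := by
  have hs : (C : Hilb n d →ₗ[ℂ] Hilb n d).IsSymmetric := hC.isSymmetric
  set U := lowEnergySpace A t
  have hinv : ∀ u ∈ U, C u ∈ U := by
    intro u hu
    induction hu using Submodule.span_induction with
    | mem u hu =>
      obtain ⟨ν, hν, hu⟩ := hu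
      refine Submodule.subset_span ⟨ν, hν, ?_⟩
      have : A (C u) = C (A u) := congrArg (fun T : Op n d => T u) hAC.eq
      rw [this, hu, map_smul]
    | zero => simp
    | add x y _ _ hx hy => rw [map_add]; exact U.add_mem hx hy
    | smul a x _ hx => rw [map_smul]; exact U.smul_mem a hx
  have hP : Commute U.starProjection C := by
    ext1 v
    refine (Submodule.eq_starProjection_of_mem_orthogonal
      (hinv _ (Submodule.starProjection_apply_mem U v)) ?_).symm ▸ rfl
    rw [Submodule.mem_orthogonal]
    intro u hu
    change inner ℂ u (C v - C (U.starProjection v)) = 0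
    rw [← map_sub]
    have h1 : inner ℂ (C u) (v - U.starProjection v) = inner ℂ u (C (v - U.starProjection v)) :=
      hs u _
    rw [← h1]
    exact Submodule.inner_right_of_mem_orthogonal (hinv u hu)
      (Submodule.sub_starProjection_mem_orthogonal v)
  exact (hAC.mul_left hP).add_left (((Commute.one_left C).sub_left hP).smul_left _)

lemma exp_apply_eigen {A : Op n d} {μ : ℝ} {v : Hilb n d} (h : A v = (μ : ℂ) • v) :
    NormedSpace.exp A v = (Real.exp μ : ℂ) • v := by
  have h1 := (NormedSpace.exp_series_hasSum_exp' (𝕂 := ℂ) A).mapL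
    (ContinuousLinearMap.apply ℂ (Hilb n d) v)
  have h2 := (NormedSpace.exp_series_hasSum_exp' (𝕂 := ℂ) (μ : ℂ)).smul_const v
  rw [← Complex.exp_eq_exp_ℂ, ← Complex.ofReal_exp] at h2
  refine h1.unique (h2.congr_fun fun k => ?_)
  have : ∀ k : ℕ, (A ^ k) v = ((μ : ℂ) ^ k) • v := by
    intro k
    induction k with
    | zero => simp
    | succ k ih => rw [pow_succ', mul_apply_eq_comp, ih, map_smul, h, smul_smul, pow_succ]
  simp [this, smul_smul]

/-- Exponential decay of the `A`-energy in a low-energy eigenvector `φ` of the truncated operator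
`min(A, t) + W + B`, where `W` commutes with `A` and conjugation by `exp (A / 4)` keeps
the boundary term `B` bounded. -/
lemma norm_exp_apply_sq_le {A W B : Op n d} (hA : A.IsPositive) (hW : W.IsPositive)
    (hAW : Commute A W)
    (hB : ‖NormedSpace.exp ((1 / 4 : ℂ) • A) * B * NormedSpace.exp (-((1 / 4 : ℂ) • A))‖ ≤ 2)
    {t E τ : ℝ} (hE : E + 3 ≤ τ) (hτ : τ ≤ t) (hτ0 : 0 ≤ τ) {φ : Hilb n d} (hφ1 : ‖φ‖ = 1)
    (hφ : (truncate A t + W + B) φ = (E : ℂ) • φ) :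
    ‖NormedSpace.exp ((1 / 4 : ℂ) • A) φ‖ ^ 2 ≤ τ * Real.exp (τ / 2) := by
  set F := NormedSpace.exp ((1 / 4 : ℂ) • A) with hF
  set F' := NormedSpace.exp (-((1 / 4 : ℂ) • A)) with hF'
  set u := F φ with hu
  obtain ⟨a, e, he⟩ := exists_isEigensystem hA.isSelfAdjoint
  have ha : ∀ i, 0 ≤ a i := fun i => by
    have h1 : 0 ≤ (inner ℂ (e i) (A (e i))).re := hA.re_inner_nonneg_right (e i)
    rw [re_inner_of_eigen (he.2 i)] at h1
    simpa using h1
  have hT : ∀ i, truncate A t (e i) = ((min (a i) t : ℝ) : ℂ) • e i := fun i =>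
    truncate_apply_eigen hA.isSelfAdjoint t (he.2 i)
  have hFe : ∀ i, F (e i) = (Real.exp (a i / 4) : ℂ) • e i := fun i =>
    exp_apply_eigen (by
      rw [smul_apply, he.2, smul_smul]
      push_cast
      congr 1
      ring)
  have hFF' : F' * F = 1 := exp_neg_mul_exp _
  have hFW : Commute W F := (hAW.symm.smul_right _).exp_right
  have hFT : Commute (truncate A t) F :=
    ((Commute.truncate_left (Commute.refl A) hA.isSelfAdjoint t).smul_right _).exp_right
  -- Apply F to the eigenvalue equation: only B fails to commute with F.
  have hkey : (truncate A t) u + W u - (E : ℂ) • u = -((F * B * F') u) := by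
    have h1 : (F * B * F') u = F (B φ) := by
      have : F' (F φ) = φ := congrArg (fun T : Op n d => T φ) hFF'
      rw [mul_apply_eq_comp, mul_apply_eq_comp, hu, this]
    have h2 : (truncate A t) u = F (truncate A t φ) :=
      congrArg (fun T : Op n d => T φ) hFT.eq
    have h3 : W u = F (W φ) := congrArg (fun T : Op n d => T φ) hFW.eq
    have h4 : truncate A t φ + W φ + B φ = (E : ℂ) • φ := hφ
    rw [h1, h2, h3, hu, ← map_smul, ← h4]
    simp only [map_add]
    abel
  have hre : (inner ℂ u ((truncate A t) u)).re - E * ‖u‖ ^ 2 ≤ 2 * ‖u‖ ^ 2 := by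
    have h1 := congrArg (fun v => (inner ℂ u v).re) hkey
    simp only [inner_sub_right, inner_add_right, inner_neg_right, inner_smul_right,
      Complex.sub_re, Complex.add_re, Complex.neg_re, Complex.re_ofReal_mul] at h1
    have h2 : (inner ℂ u u).re = ‖u‖ ^ 2 := by
      rw [inner_self_eq_norm_sq_to_K]; norm_cast
    have h3 : 0 ≤ (inner ℂ u (W u)).re := hW.re_inner_nonneg_right u
    have h4 : -(inner ℂ u ((F * B * F') u)).re ≤ 2 * ‖u‖ ^ 2 := by
      have h5 := Complex.abs_re_le_norm (inner ℂ u ((F * B * F') u))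
      have h6 := norm_inner_le_norm (𝕜 := ℂ) u ((F * B * F') u)
      have h7 := (F * B * F').le_of_opNorm_le hB u
      have h8 := neg_le_abs (inner ℂ u ((F * B * F') u)).re
      nlinarith [norm_nonneg u]
    rw [h2] at h1
    linarith
  have hcoef : ∀ i, ‖inner ℂ (e i) u‖ ^ 2 = Real.exp (a i / 2) * ‖inner ℂ (e i) φ‖ ^ 2 := fun i => by
    rw [hu, inner_apply_of_diagonal e hFe, norm_mul, mul_pow, Complex.norm_real, Real.norm_eq_abs,
      sq_abs, ← Real.exp_nat_mul]
    congr 2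
    push_cast
    ring
  rw [re_inner_apply_of_diagonal e hT] at hre
  -- This holds mode by mode. Where a i ≥ τ, the coefficient min(a i, t) - (τ - 1) is at least 1.
  -- Where a i < τ, the weight of u is at most exp(τ/2) times that of φ, and the factor τ absorbs
  -- the negative coefficient. The bracket is nonpositive by `hre` and E + 3 ≤ τ.
  have hsum : ‖u‖ ^ 2 ≤ τ * Real.exp (τ / 2) * ‖φ‖ ^ 2 +
      (∑ i, min (a i) t * ‖inner ℂ (e i) u‖ ^ 2 - (τ - 1) * ‖u‖ ^ 2) := by
    rw [← e.sum_sq_norm_inner_right u, ← e.sum_sq_norm_inner_right φ, Finset.mul_sum,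
      Finset.mul_sum, ← Finset.sum_sub_distrib, ← Finset.sum_add_distrib]
    refine Finset.sum_le_sum fun i _ => ?_
    have hp : 0 ≤ ‖inner ℂ (e i) φ‖ ^ 2 := by positivity
    have hq : 0 ≤ ‖inner ℂ (e i) u‖ ^ 2 := by positivity
    rcases le_or_gt τ (a i) with h | h
    · have h1 : τ ≤ min (a i) t := le_min h hτ
      have h2 : 0 ≤ τ * Real.exp (τ / 2) * ‖inner ℂ (e i) φ‖ ^ 2 := by positivity
      nlinarith
    · have h1 : 0 ≤ min (a i) t := le_min (ha i) (hτ0.trans hτ)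
      have h2 : ‖inner ℂ (e i) u‖ ^ 2 ≤ Real.exp (τ / 2) * ‖inner ℂ (e i) φ‖ ^ 2 := by
        rw [hcoef]
        gcongr
      nlinarith [mul_le_mul_of_nonneg_left h2 hτ0, mul_nonneg h1 hq]
  rw [hφ1] at hsum
  nlinarith [sq_nonneg ‖u‖]

/-- The energy cut off by the truncation is controlled by the exponential moment. -/
lemma re_inner_sub_truncate_le {A : Op n d} (hA : A.IsPositive) (t : ℝ) (v : Hilb n d) :
    (inner ℂ v ((A - truncate A t) v)).re ≤
      2 * Real.exp (-(t / 2)) * ‖NormedSpace.exp ((1 / 4 : ℂ) • A) v‖ ^ 2 := by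
  obtain ⟨a, e, he⟩ := exists_isEigensystem hA.isSelfAdjoint
  have hT : ∀ i, (A - truncate A t) (e i) = ((a i - min (a i) t : ℝ) : ℂ) • e i := fun i => by
    rw [sub_apply, truncate_apply_eigen hA.isSelfAdjoint t (he.2 i), he.2, ← sub_smul]
    push_cast
    rfl
  have hFe : ∀ i, NormedSpace.exp ((1 / 4 : ℂ) • A) (e i) = (Real.exp (a i / 4) : ℂ) • e i :=
    fun i => exp_apply_eigen (by
      rw [smul_apply, he.2, smul_smul]
      push_cast
      congr 1
      ring)
  rw [re_inner_apply_of_diagonal e hT, ← e.sum_sq_norm_inner_right, Finset.mul_sum]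
  refine Finset.sum_le_sum fun i _ => ?_
  rw [inner_apply_of_diagonal e hFe, norm_mul, mul_pow, Complex.norm_real, Real.norm_eq_abs,
    sq_abs, ← Real.exp_nat_mul, ← mul_assoc]
  gcongr
  rw [mul_assoc, ← Real.exp_add]
  -- With x = (a i - t)/2, the bound x + 1 ≤ exp x gives a i - t ≤ 2 exp x.
  have h1 := Real.add_one_le_exp (-(t / 2) + ((2 : ℕ) : ℝ) * (a i / 4))
  have h2 := Real.exp_pos (-(t / 2) + ((2 : ℕ) : ℝ) * (a i / 4))
  push_cast at h1 h2 ⊢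
  rcases le_total (a i) t with h | h
  · rw [min_eq_left h]; linarith
  · rw [min_eq_right h]; linarith

lemma isPositive_of_diagonal {N : ℕ} {A : Op n d} {a : Fin N → ℝ}
    (e : OrthonormalBasis (Fin N) ℂ (Hilb n d)) (he : ∀ i, A (e i) = (a i : ℂ) • e i)
    (ha : ∀ i, 0 ≤ a i) : A.IsPositive := by
  rw [ContinuousLinearMap.isPositive_def]
  constructor
  · intro x y
    change inner ℂ (A x) y = inner ℂ x (A y)
    rw [← e.sum_inner_mul_inner, ← e.sum_inner_mul_inner x]
    refine Finset.sum_congr rfl fun i _ => ?_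
    rw [← inner_conj_symm, inner_apply_of_diagonal e he, inner_apply_of_diagonal e he, map_mul,
      inner_conj_symm, Complex.conj_ofReal]
    ring
  · intro x
    have h1 : (inner ℂ x (A x)).re = _ := re_inner_apply_of_diagonal e he x
    rw [ContinuousLinearMap.reApplyInnerSelf_apply, inner_re_symm]
    refine le_of_le_of_eq (Finset.sum_nonneg fun i _ => ?_) h1.symm
    exact mul_nonneg (ha i) (by positivity)

lemma eigenvalue_nonneg {A : Op n d} (hA : A.IsPositive) {μ : ℝ} {v : Hilb n d} (hv : ‖v‖ = 1)
    (h : A v = (μ : ℂ) • v) : 0 ≤ μ := by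
  have h1 : 0 ≤ (inner ℂ v (A v)).re := hA.re_inner_nonneg_right v
  rw [re_inner_of_eigen h] at h1
  simpa [hv] using h1

lemma isPositive_truncate {A : Op n d} (hA : A.IsPositive) {t : ℝ} (ht : 0 ≤ t) :
    (truncate A t).IsPositive := by
  obtain ⟨a, e, he⟩ := exists_isEigensystem hA.isSelfAdjoint
  exact isPositive_of_diagonal e (fun i => truncate_apply_eigen hA.isSelfAdjoint t (he.2 i))
    fun i => le_min (eigenvalue_nonneg hA (by simp) (he.2 i)) ht

lemma isPositive_sub_truncate {A : Op n d} (hA : A.IsPositive) (t : ℝ) :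
    (A - truncate A t).IsPositive := by
  obtain ⟨a, e, he⟩ := exists_isEigensystem hA.isSelfAdjoint
  refine isPositive_of_diagonal e (a := fun i => a i - min (a i) t) (fun i => ?_)
    fun i => sub_nonneg.2 (min_le_left _ _)
  rw [sub_apply, truncate_apply_eigen hA.isSelfAdjoint t (he.2 i), he.2, ← sub_smul]
  push_cast
  rfl

end Truncate

/-! ### Gluing states of complementary regions -/

section Slice

variable {ι κ : Type*}

open scoped Classical in
/-- The configuration that agrees with `σ` on `S` and with `c` elsewhere. -/
def mix (S : Set ι) (σ c : ι → κ) : ι → κ := fun j => if j ∈ S then σ j else c j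

lemma mix_of_mem {S : Set ι} {j : ι} (hj : j ∈ S) (σ c : ι → κ) : mix S σ c j = σ j := if_pos hj

lemma mix_of_notMem {S : Set ι} {j : ι} (hj : j ∉ S) (σ c : ι → κ) : mix S σ c j = c j := if_neg hj

lemma mix_congr {S : Set ι} {σ σ' c c' : ι → κ} (h : ∀ j ∈ S, σ j = σ' j)
    (h' : ∀ j ∉ S, c j = c' j) : mix S σ c = mix S σ' c' := by
  funext j
  by_cases hj : j ∈ S
  · rw [mix_of_mem hj, mix_of_mem hj, h j hj]
  · rw [mix_of_notMem hj, mix_of_notMem hj, h' j hj]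

lemma mix_self (S : Set ι) (σ : ι → κ) : mix S σ σ = σ := by
  funext j
  simp [mix]

lemma mix_compl (S : Set ι) (σ c : ι → κ) : mix Sᶜ σ c = mix S c σ := by
  funext j
  by_cases hj : j ∈ S <;> simp [mix, hj]

open scoped Classical in
/-- The matrix that projects the sites in `S` to the configuration `a` and replaces their state
by the slice of `g` at the configuration `c` of the other sites. -/
def sliceMatrix (S : Set ι) (a c : ι → κ) (g : (ι → κ) → ℂ) : Matrix (ι → κ) (ι → κ) ℂ :=
  Matrix.of fun σ τ => if τ = mix S a σ then g (mix S σ c) else 0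

lemma isLocal_sliceMatrix (S : Set ι) (a c : ι → κ) (g : (ι → κ) → ℂ) :
    IsLocal S (sliceMatrix S a c g) where
  eq_zero σ τ j hj h := by
    refine if_neg fun hτ => h ?_
    rw [hτ, mix_of_notMem hj]
  congr σ τ σ' τ' h1 h2 h3 h4 := by
    simp only [sliceMatrix, Matrix.of_apply]
    have hiff : τ = mix S a σ ↔ τ' = mix S a σ' := by
      simp only [funext_iff]
      refine forall_congr' fun j => ?_
      by_cases hj : j ∈ S
      · rw [mix_of_mem hj, mix_of_mem hj, h2 j hj]
      · rw [mix_of_notMem hj, mix_of_notMem hj, h3 j hj, h4 j hj]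
        simp
    rw [mix_congr h1 (fun _ _ => rfl)]
    classical exact if_congr hiff rfl rfl

end Slice

section Product

variable {n d : ℕ}

lemma toOp_sliceMatrix_apply (S : Set (Fin (2 * n + 1 + 1))) (a c : Config n d)
    (g : Config n d → ℂ) (v : Hilb n d) (σ : Config n d) :
    toOp (sliceMatrix S a c g) v σ = g (mix S σ c) * v (mix S a σ) := by
  rw [Matrix.ofLp_toEuclideanCLM, Matrix.mulVec, dotProduct]
  simp [sliceMatrix]

/-- `A` commutes with every operator that acts on the sites outside `S`. -/
def ActsOn (S : Set (Fin (2 * n + 1 + 1))) (A : Op n d) : Prop :=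
  ∀ M : Matrix (Config n d) (Config n d) ℂ, IsLocal Sᶜ M → Commute (toOp M) A

lemma actsOn_sum_bondTerm (h : Interaction n d) (S : Set (Fin (2 * n + 1 + 1)))
    (s : Finset (Fin (2 * n + 1))) (hs : ∀ k ∈ s, k.castSucc ∈ S ∧ k.succ ∈ S) :
    ActsOn S (∑ k ∈ s, bondTerm h k) := fun _ hM =>
  Commute.sum_right _ _ _ fun k hk =>
    commute_toOp_bondTerm hM (not_not.2 (hs k hk).1) (not_not.2 (hs k hk).2)

lemma eigen_of_commute {A T : Op n d} (hT : Commute T A) {μ : ℂ} {ξ : Hilb n d}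
    (h : A ξ = μ • ξ) : A (T ξ) = μ • T ξ := by
  have : A (T ξ) = T (A ξ) := congrArg (fun X : Op n d => X ξ) hT.eq.symm
  rw [this, h, map_smul]

/-- A vector that looks like `ξ₁` on the sites in `S` and like `ξ₂` on the other sites. -/
lemma exists_product_vector (S : Set (Fin (2 * n + 1 + 1))) {ξ₁ ξ₂ : Hilb n d} (h₁ : ξ₁ ≠ 0)
    (h₂ : ξ₂ ≠ 0) : ∃ v : Hilb n d, v ≠ 0 ∧
      (∀ (A : Op n d) (μ : ℂ), ActsOn S A → A ξ₁ = μ • ξ₁ → A v = μ • v) ∧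
      ∀ (A : Op n d) (μ : ℂ), ActsOn Sᶜ A → A ξ₂ = μ • ξ₂ → A v = μ • v := by
  obtain ⟨a₁, ha₁⟩ : ∃ σ, ξ₁ σ ≠ 0 := by
    by_contra! h
    exact h₁ (by ext σ; simpa using h σ)
  obtain ⟨a₂, ha₂⟩ : ∃ σ, ξ₂ σ ≠ 0 := by
    by_contra! h
    exact h₂ (by ext σ; simpa using h σ)
  -- Both sides are the product of a slice of ξ₁ and a slice of ξ₂. The vector thus arises from ξ₁
  -- by an operator on Sᶜ and from ξ₂ by one on S, so both families of eigenvalue equations carry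
  -- over by commutation.
  have heq : toOp (sliceMatrix Sᶜ a₁ a₂ ξ₂) ξ₁ = toOp (sliceMatrix S a₂ a₁ ξ₁) ξ₂ := by
    ext σ
    rw [toOp_sliceMatrix_apply, toOp_sliceMatrix_apply, mix_compl, mix_compl, mul_comm]
  refine ⟨toOp (sliceMatrix Sᶜ a₁ a₂ ξ₂) ξ₁, fun h0 => ?_, fun A μ hA hξ => ?_, fun A μ hA hξ => ?_⟩
  · have h1 := congrArg (fun v : Hilb n d => v (mix S a₁ a₂)) h0
    simp only [toOp_sliceMatrix_apply, mix_compl, PiLp.zero_apply] at h1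
    have e1 : mix S a₂ (mix S a₁ a₂) = a₂ := by
      conv_rhs => rw [← mix_self S a₂]
      exact mix_congr (fun _ _ => rfl) fun j hj => mix_of_notMem hj _ _
    have e2 : mix S (mix S a₁ a₂) a₁ = a₁ := by
      conv_rhs => rw [← mix_self S a₁]
      exact mix_congr (fun j hj => mix_of_mem hj _ _) fun _ _ => rfl
    rw [e1, e2] at h1
    exact mul_ne_zero ha₂ ha₁ h1
  · exact eigen_of_commute (hA _ (isLocal_sliceMatrix _ _ _ _)) hξ
  · rw [heq]
    exact eigen_of_commute (hA _ (by rw [compl_compl]; exact isLocal_sliceMatrix _ _ _ _)) hξ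

end Product

/-! ### Splitting the Hamiltonian at the two cut bonds -/

section Decomposition

variable {n d : ℕ} (h : Interaction n d)

/-- The bond `-s`. -/
def leftCut (n s : ℕ) : Fin (2 * n + 1) := ⟨n - s, by omega⟩

/-- The bond `s`. -/
def rightCut {n s : ℕ} (hs : s ≤ n) : Fin (2 * n + 1) := ⟨n + s, by omega⟩

lemma pos_leftCut {n s : ℕ} (hs : s ≤ n) : pos (leftCut n s) = -s := by
  simp only [pos, leftCut]; omega

lemma pos_rightCut {n s : ℕ} (hs : s ≤ n) : pos (rightCut hs) = s := by
  simp only [pos, rightCut]; omega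

lemma pos_injective : Function.Injective (pos (n := n)) := fun k l hkl => by
  simp only [pos] at hkl
  ext
  omega

lemma card_abs_pos_lt {s : ℕ} (hs1 : 1 ≤ s) (hs : s ≤ n) :
    (Finset.univ.filter fun k : Fin (2 * n + 1) => |pos k| < (s : ℤ)).card = 2 * s - 1 := by
  have h1 : (Finset.univ.filter fun k : Fin (2 * n + 1) => |pos k| < (s : ℤ)).card =
      (Finset.Ioo (-(s : ℤ)) s).card := by
    refine Finset.card_bij (fun k _ => pos k) (fun k hk => ?_) (fun k _ l _ hkl =>
      pos_injective hkl) fun i hi => ?_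
    · simpa [abs_lt] using hk
    · rw [Finset.mem_Ioo] at hi
      refine ⟨⟨(i + n).toNat, by omega⟩, ?_, ?_⟩
      · simp only [Finset.mem_filter, Finset.mem_univ, true_and, pos, abs_lt]
        omega
      · simp only [pos]
        omega
  rw [h1, Int.card_Ioo]
  omega

/-- `H_M = H'_M - ε₀(H'_M)`. -/
def middlePart (s : ℕ) : Op n d := middleBare h s - (groundEnergy (middleBare h s) : ℂ) • 1

lemma filter_abs_pos_eq {s : ℕ} (hs : s ≤ n) :
    (Finset.univ.filter fun k : Fin (2 * n + 1) => |pos k| = (s : ℤ)) =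
      {leftCut n s, rightCut hs} := by
  ext k
  simp only [Finset.mem_filter, Finset.mem_univ, true_and, Finset.mem_insert,
    Finset.mem_singleton, ← pos_injective.eq_iff (a := k), pos_leftCut hs, pos_rightCut hs]
  rw [abs_eq (by positivity), or_comm]

lemma leftCut_ne_rightCut {s : ℕ} (hs1 : 1 ≤ s) (hs : s ≤ n) : leftCut n s ≠ rightCut hs := by
  intro h
  have := congrArg pos h
  rw [pos_leftCut hs, pos_rightCut hs] at this
  omega

/-- There are exactly 2s - 1 bonds with |i| < s, so the shifts per bond add up to ε₀(H'_M). -/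
lemma centralPart_eq {s : ℕ} (hs1 : 1 ≤ s) (hs : s ≤ n) :
    centralPart h s = bondTerm h (leftCut n s) + bondTerm h (rightCut hs) + middlePart h s := by
  have hsplit : centralPart h s =
      (∑ k with |pos k| = (s : ℤ), centralTerm h s k) +
        ∑ k with |pos k| < (s : ℤ), centralTerm h s k := by
    rw [centralPart, ← Finset.sum_filter_add_sum_filter_not _ fun k => |pos k| = (s : ℤ),
      Finset.filter_filter, Finset.filter_filter]
    congr 2 <;> ext k <;> simp only [Finset.mem_filter, Finset.mem_univ, true_and] <;> omega
  rw [hsplit]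
  congr 1
  · rw [← Finset.sum_pair (leftCut_ne_rightCut hs1 hs), ← filter_abs_pos_eq hs]
    refine Finset.sum_congr rfl fun k hk => ?_
    rw [centralTerm, if_pos (Finset.mem_filter.1 hk).2]
  · have h1 : ∀ k ∈ Finset.univ.filter fun k : Fin (2 * n + 1) => |pos k| < (s : ℤ),
        centralTerm h s k = bondTerm h k -
          ((groundEnergy (middleBare h s) / (2 * (s : ℝ) - 1) : ℝ) : ℂ) • 1 := fun k hk => by
      rw [centralTerm, if_neg (Finset.mem_filter.1 hk).2.ne]
    rw [Finset.sum_congr rfl h1, Finset.sum_sub_distrib, Finset.sum_const, card_abs_pos_lt hs1 hs,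
      middlePart, middleBare, ← Nat.cast_smul_eq_nsmul ℂ, smul_smul]
    congr 2
    have h2 : ((2 * s - 1 : ℕ) : ℝ) = 2 * (s : ℝ) - 1 := by
      rw [Nat.cast_sub (by omega)]; simp
    have h3 : (2 * (s : ℝ) - 1) ≠ 0 := by
      have : (1 : ℝ) ≤ s := by exact_mod_cast hs1
      linarith
    rw [← Complex.ofReal_natCast, h2, ← Complex.ofReal_mul, mul_div_cancel₀ _ h3]

/-- Up to a scalar, H is the plain sum of all bonds, so it can also be split at places unrelated to
±s. -/
lemma hamiltonian_eq {s : ℕ} (hs1 : 1 ≤ s) (hs : s ≤ n) :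
    hamiltonian h s = ∑ k, bondTerm h k - ((groundEnergy (leftBare h s) +
      groundEnergy (middleBare h s) + groundEnergy (rightBare h s) : ℝ) : ℂ) • 1 := by
  have hsplit : ∑ k, bondTerm h k = leftBare h s + (bondTerm h (leftCut n s) +
      bondTerm h (rightCut hs) + middleBare h s) + rightBare h s := by
    rw [← Finset.sum_pair (leftCut_ne_rightCut hs1 hs), ← filter_abs_pos_eq hs, leftBare,
      middleBare, rightBare]
    simp only [Finset.sum_filter, ← Finset.sum_add_distrib]
    refine Finset.sum_congr rfl fun k _ => ?_
    rcases lt_trichotomy (pos k) (-s) with h1 | h1 | h1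
    · rw [if_pos h1, if_neg (by grind), if_neg (by grind), if_neg (by omega)]; simp
    · rw [if_neg (by omega), if_pos (by grind), if_neg (by grind), if_neg (by omega)]; simp
    · rcases lt_trichotomy (pos k) s with h2 | h2 | h2
      · rw [if_neg (by omega), if_neg (by grind), if_pos (by grind), if_neg (by omega)]; simp
      · rw [if_neg (by omega), if_pos (by grind), if_neg (by grind), if_neg (by omega)]; simp
      · rw [if_neg (by omega), if_neg (by grind), if_neg (by grind), if_pos (by omega)]; simp
  rw [hamiltonian, centralPart_eq h hs1 hs, hsplit, leftPart, middlePart, rightPart]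
  have e : ∀ a b : ℂ, (a + b) • (1 : Op n d) = a • 1 + b • 1 :=
    fun a b => add_smul a b (1 : Op n d)
  rw [Complex.ofReal_add, Complex.ofReal_add, e, e]
  abel

end Decomposition

/-! ### A priori bounds on the low-lying spectrum -/

section Energy

variable {n d : ℕ} {h : Interaction n d}

lemma isPositive_sum_bondTerm (hh : h.IsNormalized) (s : Finset (Fin (2 * n + 1))) :
    (∑ k ∈ s, bondTerm h k).IsPositive :=
  ContinuousLinearMap.isPositive_sum s fun k _ => isPositive_bondTerm hh k

lemma re_inner_bondTerm_nonneg (hh : h.IsNormalized) (k : Fin (2 * n + 1)) (v : Hilb n d) :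
    0 ≤ (inner ℂ v (bondTerm h k v)).re :=
  (isPositive_bondTerm hh k).re_inner_nonneg_right v

lemma re_inner_bondTerm_le (hh : h.IsNormalized) (k : Fin (2 * n + 1)) (v : Hilb n d) :
    (inner ℂ v (bondTerm h k v)).re ≤ ‖v‖ ^ 2 := by
  have h1 := Complex.re_le_norm (inner ℂ v (bondTerm h k v))
  have h2 := norm_inner_le_norm (𝕜 := ℂ) v (bondTerm h k v)
  have h3 := (bondTerm h k).le_of_opNorm_le (norm_bondTerm_le_one hh k) v
  nlinarith [norm_nonneg v]

lemma isPositive_sub_groundEnergy [Nontrivial (Hilb n d)] {A : Op n d} (hA : IsSelfAdjoint A) :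
    (A - (groundEnergy A : ℂ) • 1).IsPositive := by
  have hsa : IsSelfAdjoint (A - (groundEnergy A : ℂ) • (1 : Op n d)) :=
    IsSelfAdjoint.sub (R := Op n d) hA
      (IsSelfAdjoint.smul (A := Op n d) (Complex.conj_ofReal _) (IsSelfAdjoint.one _))
  rw [ContinuousLinearMap.isPositive_def]
  refine ⟨hsa.isSymmetric, fun v => ?_⟩
  have h1 := (exists_ground hA).2 v
  have h2 : (inner ℂ v v).re = ‖v‖ ^ 2 := inner_self_eq_norm_sq (𝕜 := ℂ) v
  rw [ContinuousLinearMap.reApplyInnerSelf_apply, inner_re_symm]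
  change 0 ≤ (inner ℂ v (A v - (groundEnergy A : ℂ) • v)).re
  rw [inner_sub_right, inner_smul_right, Complex.sub_re, Complex.re_ofReal_mul, h2]
  linarith

/-- The bonds that avoid the first `f + 1` spins. -/
def farBonds (n f : ℕ) : Finset (Fin (2 * n + 1)) := Finset.univ.filter fun k => f < k.val

/-- An eigenspace of a sum of bonds that avoid the first `f + 1` spins has dimension `> f`. -/
lemma lt_finrank_eigenspace {f : ℕ} (hd : 2 ≤ d) (hf : f < 2 * n + 1 + 1) {μ : ℂ} {ξ : Hilb n d}
    (hξ0 : ξ ≠ 0)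
    (hξ : (∑ k ∈ farBonds n f, bondTerm h k) ξ = μ • ξ) :
    f < Module.finrank ℂ (Module.End.eigenspace
      ((∑ k ∈ farBonds n f, bondTerm h k : Op n d) :
        Hilb n d →ₗ[ℂ] Hilb n d) μ) := by
  obtain ⟨a, ha⟩ : ∃ σ, ξ σ ≠ 0 := by
    by_contra! h
    exact hξ0 (by ext σ; simpa using h σ)
  have hne : ∀ j, ∃ x : Fin d, x ≠ a j := fun j => by
    have : Nontrivial (Fin d) := Fin.nontrivial_iff_two_le.2 hd
    exact exists_ne (a j)
  choose x hx using hne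
  let site : Fin (f + 1) → Fin (2 * n + 1 + 1) := Fin.castLE hf
  have hsite : Function.Injective site := Fin.castLE_injective hf
  let T : Fin (f + 1) → Op n d := fun j =>
    toOp (sliceMatrix {site j} a a fun σ => if σ (site j) = x (site j) then 1 else 0)
  have hTmem : ∀ j, T j ξ ∈ Module.End.eigenspace
      ((∑ k ∈ farBonds n f, bondTerm h k : Op n d) :
        Hilb n d →ₗ[ℂ] Hilb n d) μ := fun j => by
    rw [Module.End.mem_eigenspace_iff]
    refine eigen_of_commute (Commute.sum_right _ _ _ fun k hk => ?_) hξ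
    rw [farBonds, Finset.mem_filter] at hk
    have hj := j.2
    refine commute_toOp_bondTerm (isLocal_sliceMatrix _ _ _ _) ?_ ?_ <;>
    · simp only [Set.mem_singleton_iff, site, Fin.ext_iff, Fin.val_castSucc, Fin.val_succ,
        Fin.val_castLE]
      omega
  let y : Fin (f + 1) → Config n d := fun j => Function.update a (site j) (x (site j))
  -- T i resets the free spin i from a to a different value. Evaluation at the configurations y j,
  -- which differ from a in one spin, separates these vectors.
  have hT : ∀ i j, T i ξ (y j) = if i = j then ξ a else 0 := fun i j => by
    simp only [T]
    rw [toOp_sliceMatrix_apply, mix_of_mem (Set.mem_singleton _)]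
    by_cases hij : i = j
    · subst hij
      have : mix {site i} a (y i) = a := by
        conv_rhs => rw [← mix_self {site i} a]
        refine mix_congr (fun _ _ => rfl) fun l hl => ?_
        exact Function.update_of_ne hl _ _
      simp [this, y]
    · have : site i ≠ site j := hsite.ne hij
      simp [y, this, hij, (hx _).symm]
  have hli : LinearIndependent ℂ fun j => (⟨T j ξ, hTmem j⟩ : Module.End.eigenspace
      ((∑ k ∈ farBonds n f, bondTerm h k : Op n d) :
        Hilb n d →ₗ[ℂ] Hilb n d) μ) := by
    rw [Fintype.linearIndependent_iff]
    intro g hg i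
    have h1 : ∑ j, g j • T j ξ = 0 := by
      have := congrArg Subtype.val hg
      simpa using this
    have h2 := congrArg (fun v : Hilb n d => v (y i)) h1
    simpa [hT, ha] using h2
  have := hli.fintype_card_le_finrank
  rw [Fintype.card_fin] at this
  omega

variable [Nontrivial (Hilb n d)]

lemma isPositive_leftPart (hh : h.IsNormalized) (s : ℕ) : (leftPart h s).IsPositive :=
  isPositive_sub_groundEnergy (isPositive_sum_bondTerm hh _).isSelfAdjoint

lemma isPositive_rightPart (hh : h.IsNormalized) (s : ℕ) : (rightPart h s).IsPositive :=
  isPositive_sub_groundEnergy (isPositive_sum_bondTerm hh _).isSelfAdjoint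

lemma isPositive_middlePart (hh : h.IsNormalized) (s : ℕ) : (middlePart h s).IsPositive :=
  isPositive_sub_groundEnergy (isPositive_sum_bondTerm hh _).isSelfAdjoint

/-- The three decoupled parts of the chain have a common ground state. -/
lemma exists_common_ground (hh : h.IsNormalized) (s : ℕ) :
    ∃ v : Hilb n d, v ≠ 0 ∧ leftPart h s v = 0 ∧ middlePart h s v = 0 ∧ rightPart h s v = 0 := by
  obtain ⟨ξL, hL0, hL⟩ := (exists_ground (isPositive_sum_bondTerm (h := h) hh
    (Finset.univ.filter fun k => pos k < -(s : ℤ))).isSelfAdjoint).1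
  obtain ⟨ξM, hM0, hM⟩ := (exists_ground (isPositive_sum_bondTerm (h := h) hh
    (Finset.univ.filter fun k => |pos k| < (s : ℤ))).isSelfAdjoint).1
  obtain ⟨ξR, hR0, hR⟩ := (exists_ground (isPositive_sum_bondTerm (h := h) hh
    (Finset.univ.filter fun k => (s : ℤ) < pos k)).isSelfAdjoint).1
  obtain ⟨w, hw0, hwL, hwM⟩ := exists_product_vector
    {j : Fin (2 * n + 1 + 1) | (j : ℤ) - n ≤ -s} hL0 hM0
  obtain ⟨v, hv0, hvw, hvR⟩ := exists_product_vector
    {j : Fin (2 * n + 1 + 1) | (j : ℤ) - n ≤ s} hw0 hR0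
  refine ⟨v, hv0, sub_eq_zero.2 (hvw _ _ (actsOn_sum_bondTerm h _ _ fun k hk => ?_)
    (hwL _ _ (actsOn_sum_bondTerm h _ _ fun k hk => ?_) hL)),
    sub_eq_zero.2 (hvw _ _ (actsOn_sum_bondTerm h _ _ fun k hk => ?_)
      (hwM _ _ (actsOn_sum_bondTerm h _ _ fun k hk => ?_) hM)),
    sub_eq_zero.2 (hvR _ _ (actsOn_sum_bondTerm h _ _ fun k hk => ?_) hR)⟩
  all_goals
    have hk' := (Finset.mem_filter.1 hk).2
    simp only [pos, abs_lt] at hk'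
    simp only [Set.mem_compl_iff, Set.mem_ofPred_eq, Fin.val_castSucc, Fin.val_succ]
    omega

lemma groundEnergy_le_two (hh : h.IsNormalized) {s : ℕ} (hs1 : 1 ≤ s) (hs : s ≤ n) {N : ℕ}
    (hN : 0 < N) {E : Fin N → ℝ} {ψ : OrthonormalBasis (Fin N) ℂ (Hilb n d)}
    (hE : IsEigensystem (hamiltonian h s) E ψ) : E ⟨0, hN⟩ ≤ 2 := by
  obtain ⟨v, hv0, hL, hM, hR⟩ := exists_common_ground hh s
  have h1 := hE.le_re_inner hN v
  have h2 : hamiltonian h s v = bondTerm h (leftCut n s) v + bondTerm h (rightCut hs) v := by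
    rw [hamiltonian, centralPart_eq h hs1 hs]
    simp only [add_apply, hL, hM, hR, add_zero, zero_add]
  rw [h2, inner_add_right, Complex.add_re] at h1
  have h3 := re_inner_bondTerm_le hh (leftCut n s) v
  have h4 := re_inner_bondTerm_le hh (rightCut hs) v
  have : 0 < ‖v‖ ^ 2 := by positivity
  exact le_of_mul_le_mul_right (by linarith) this

/-- A bound on the `f`-th excitation energy. -/
lemma excitation_le (hh : h.IsNormalized) {s : ℕ} (hs1 : 1 ≤ s) (hs : s ≤ n) (hd : 2 ≤ d)
    {N f : ℕ} (hN : f < N) {E : Fin N → ℝ} {ψ : OrthonormalBasis (Fin N) ℂ (Hilb n d)}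
    (hE : IsEigensystem (hamiltonian h s) E ψ) :
    E ⟨f, hN⟩ ≤ E ⟨0, by omega⟩ + (f + 1) := by
  set κ : ℝ := groundEnergy (leftBare h s) + groundEnergy (middleBare h s) +
    groundEnergy (rightBare h s) with hκ
  set near : Finset (Fin (2 * n + 1)) := Finset.univ.filter fun k => ¬ f < k.val with hnear
  set A : Op n d := ∑ k ∈ farBonds n f, bondTerm h k with hA
  have hform : ∀ v, (inner ℂ v (hamiltonian h s v)).re = (inner ℂ v (A v)).re +
      ∑ k ∈ near, (inner ℂ v (bondTerm h k v)).re - κ * ‖v‖ ^ 2 := fun v => by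
    have h2 : (inner ℂ v v).re = ‖v‖ ^ 2 := inner_self_eq_norm_sq (𝕜 := ℂ) v
    have h3 : A + ∑ k ∈ near, bondTerm h k = ∑ k, bondTerm h k :=
      Finset.sum_filter_add_sum_filter_not _ _ _
    rw [hamiltonian_eq h hs1 hs, ← hκ, ← h3, sub_apply, add_apply,
      smul_apply, one_apply_eq_self, inner_sub_right, inner_add_right, inner_smul_right,
      Complex.sub_re, Complex.add_re, Complex.re_ofReal_mul, h2, sum_apply near, inner_sum,
      Complex.re_sum]
  have hcard : (near.card : ℝ) ≤ f + 1 := by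
    have := Finset.card_le_card_of_injOn (s := near) (t := Finset.range (f + 1))
      (fun k => (k : ℕ)) (fun k hk => by
        simp only [hnear, Finset.coe_filter, Finset.mem_univ, true_and, Set.mem_ofPred_eq] at hk
        simp only [Finset.coe_range, Set.mem_Iio]
        omega) (fun _ _ _ _ hkl => Fin.ext hkl)
    rw [Finset.card_range] at this
    exact_mod_cast this
  obtain ⟨⟨ξ, hξ0, hξ⟩, hg⟩ := exists_ground (isPositive_sum_bondTerm (h := h) hh
    (farBonds n f)).isSelfAdjoint
  rw [← hA] at hξ hg
  -- The at most f + 1 near bonds are nonnegative, so dropping them can only lower the energy.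
  -- Conversely, they cost at most f + 1 on the ground space of A, whose dimension exceeds f.
  have hlow : groundEnergy A - κ ≤ E ⟨0, by omega⟩ := by
    have h1 := re_inner_of_eigen (hE.2 ⟨0, by omega⟩)
    rw [hform, ψ.norm_eq_one] at h1
    have h2 := hg (ψ ⟨0, by omega⟩)
    rw [ψ.norm_eq_one] at h2
    have h3 : 0 ≤ ∑ k ∈ near, (inner ℂ (ψ ⟨0, by omega⟩) (bondTerm h k (ψ ⟨0, by omega⟩))).re :=
      Finset.sum_nonneg fun k _ => re_inner_bondTerm_nonneg hh k _
    linarith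
  refine hE.le_of_forall_mem ⟨f, hN⟩ (Module.End.eigenspace (A : Hilb n d →ₗ[ℂ] Hilb n d)
    (groundEnergy A : ℂ)) ?_ _ fun v hv => ?_
  · rcases lt_or_ge f (2 * n + 1 + 1) with hf | hf
    · exact lt_finrank_eigenspace hd hf hξ0 hξ
    -- If f is at least the number of spins, no far bond is left and the whole space serves as the
    -- eigenspace.
    · have hA0 : A = 0 := by
        rw [hA]
        refine Finset.sum_eq_zero fun k hk => ?_
        have := (Finset.mem_filter.1 hk).2
        omega
      have hg0 : (groundEnergy A : ℂ) = 0 := by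
        have h0 : (0 : Hilb n d) = (groundEnergy A : ℂ) • ξ := by rw [← hξ, hA0]; rfl
        exact (smul_eq_zero.1 h0.symm).resolve_right hξ0
      have htop : Module.End.eigenspace (A : Hilb n d →ₗ[ℂ] Hilb n d) (groundEnergy A : ℂ) = ⊤ := by
        rw [hg0, hA0, eq_top_iff]
        intro v _
        rw [Module.End.mem_eigenspace_iff]
        simp
      rw [htop, finrank_top, Module.finrank_eq_card_basis ψ.toBasis, Fintype.card_fin]
      exact hN
  · have h1 := re_inner_of_eigen (A := A) (Module.End.mem_eigenspace_iff.1 hv)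
    have h2 : ∑ k ∈ near, (inner ℂ v (bondTerm h k v)).re ≤ (f + 1) * ‖v‖ ^ 2 := by
      refine (Finset.sum_le_card_nsmul _ _ _ fun k _ => re_inner_bondTerm_le hh k v).trans ?_
      rw [nsmul_eq_mul]
      gcongr
    rw [hform, h1]
    nlinarith [sq_nonneg ‖v‖]

end Energy

/-! ### Bounds and commutation at the cuts -/

section Boundary

variable {n d : ℕ} {h : Interaction n d}

/-- Bonds are labelled by their distance to the cut, starting at 1. The weight 1/4 is what the
locality bound requires of terms of norm at most 1. -/
lemma norm_conj_leftCut_le (hh : h.IsNormalized) {s : ℕ} (hs : s ≤ n) :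
    ‖NormedSpace.exp ((1 / 4 : ℂ) • leftPart h s) * bondTerm h (leftCut n s) *
      NormedSpace.exp (-((1 / 4 : ℂ) • leftPart h s))‖ ≤ 2 := by
  refine (norm_exp_conj_le (Finset.univ.filter fun k => pos k < -(s : ℤ))
    (fun k => (1 / 4 : ℂ) • bondTerm h k) (fun k => (-(s : ℤ) - pos k).toNat) ?_ ?_ ?_ ?_ _ ?_ _
    (1 / 4 * groundEnergy (leftBare h s)) ?_).trans
    (by linarith [norm_bondTerm_le_one hh (leftCut n s)])
  · intro k hk l hl hkl
    simp only [Finset.coe_filter, Finset.mem_univ, true_and, Set.mem_ofPred_eq] at hk hl hkl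
    exact pos_injective (by omega)
  · intro k hk
    have := (Finset.mem_filter.1 hk).2
    omega
  · intro k _
    rw [norm_smul]
    have := norm_bondTerm_le_one hh k
    norm_num
    linarith
  · intro k hk l hl hkl
    have h1 := (Finset.mem_filter.1 hk).2
    have h2 := (Finset.mem_filter.1 hl).2
    exact ((commute_bondTerm h (k := l) (l := k) (by omega)).symm.smul_left _).smul_right _
  · intro l hl hlt
    have h2 := (Finset.mem_filter.1 hl).2
    exact (commute_bondTerm h (k := l) (by rw [pos_leftCut hs]; omega)).symm.smul_right _
  · rw [leftPart, leftBare, smul_sub, Finset.smul_sum, smul_smul]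

lemma norm_conj_rightCut_le (hh : h.IsNormalized) {s : ℕ} (hs : s ≤ n) :
    ‖NormedSpace.exp ((1 / 4 : ℂ) • rightPart h s) * bondTerm h (rightCut hs) *
      NormedSpace.exp (-((1 / 4 : ℂ) • rightPart h s))‖ ≤ 2 := by
  refine (norm_exp_conj_le (Finset.univ.filter fun k => (s : ℤ) < pos k)
    (fun k => (1 / 4 : ℂ) • bondTerm h k) (fun k => (pos k - s).toNat) ?_ ?_ ?_ ?_ _ ?_ _
    (1 / 4 * groundEnergy (rightBare h s)) ?_).trans
    (by linarith [norm_bondTerm_le_one hh (rightCut hs)])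
  · intro k hk l hl hkl
    simp only [Finset.coe_filter, Finset.mem_univ, true_and, Set.mem_ofPred_eq] at hk hl hkl
    exact pos_injective (by omega)
  · intro k hk
    have := (Finset.mem_filter.1 hk).2
    omega
  · intro k _
    rw [norm_smul]
    have := norm_bondTerm_le_one hh k
    norm_num
    linarith
  · intro k hk l hl hkl
    have h1 := (Finset.mem_filter.1 hk).2
    have h2 := (Finset.mem_filter.1 hl).2
    exact ((commute_bondTerm h (k := k) (l := l) (by omega)).smul_left _).smul_right _
  · intro l hl hlt
    have h2 := (Finset.mem_filter.1 hl).2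
    exact (commute_bondTerm h (l := l) (by rw [pos_rightCut hs]; omega)).smul_right _
  · rw [rightPart, rightBare, smul_sub, Finset.smul_sum, smul_smul]

/-- Sums of bonds on two separated stretches of the chain commute. -/
lemma commute_sum_bondTerm (h : Interaction n d) (S S' : Finset (Fin (2 * n + 1)))
    (hS : ∀ k ∈ S, ∀ l ∈ S', pos k + 1 < pos l) (z z' : ℂ) :
    Commute (∑ k ∈ S, bondTerm h k - z • 1) (∑ k ∈ S', bondTerm h k - z' • 1) := by
  have h1 : Commute (∑ k ∈ S, bondTerm h k) (∑ k ∈ S', bondTerm h k) :=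
    Commute.sum_left _ _ _ fun k hk => Commute.sum_right _ _ _ fun l hl =>
      commute_bondTerm h (hS k hk l hl)
  refine (h1.sub_left ?_).sub_right (((Commute.one_right _).smul_right _))
  exact (Commute.one_left _).smul_left _

lemma commute_leftPart_middlePart (h : Interaction n d) (s : ℕ) :
    Commute (leftPart h s) (middlePart h s) := by
  refine commute_sum_bondTerm h _ _ (fun k hk l hl => ?_) _ _
  simp only [Finset.mem_filter, Finset.mem_univ, true_and, abs_lt] at hk hl
  omega

lemma commute_middlePart_rightPart (h : Interaction n d) (s : ℕ) :
    Commute (middlePart h s) (rightPart h s) := by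
  refine commute_sum_bondTerm h _ _ (fun k hk l hl => ?_) _ _
  simp only [Finset.mem_filter, Finset.mem_univ, true_and, abs_lt] at hk hl
  omega

lemma commute_leftPart_rightPart (h : Interaction n d) {s : ℕ} (hs1 : 1 ≤ s) :
    Commute (leftPart h s) (rightPart h s) := by
  refine commute_sum_bondTerm h _ _ (fun k hk l hl => ?_) _ _
  simp only [Finset.mem_filter, Finset.mem_univ, true_and] at hk hl
  omega

lemma commute_leftPart_rightCut (h : Interaction n d) {s : ℕ} (hs1 : 1 ≤ s) (hs : s ≤ n) :
    Commute (leftPart h s) (bondTerm h (rightCut hs)) := by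
  refine (Commute.sum_left _ _ _ fun k hk => commute_bondTerm h ?_).sub_left
    ((Commute.one_left _).smul_left _)
  rw [pos_rightCut]
  have := (Finset.mem_filter.1 hk).2
  omega

lemma commute_leftCut_rightPart (h : Interaction n d) {s : ℕ} (hs1 : 1 ≤ s) (hs : s ≤ n) :
    Commute (bondTerm h (leftCut n s)) (rightPart h s) := by
  refine (Commute.sum_right _ _ _ fun k hk => commute_bondTerm h ?_).sub_right
    ((Commute.one_right _).smul_right _)
  rw [pos_leftCut hs]
  have := (Finset.mem_filter.1 hk).2
  omega

end Boundary

/-! ### Perturbation of eigenvalues and eigenvectors -/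

section Perturbation

variable {n d N : ℕ}

/-- The span of the first `i + 1` vectors of a basis. -/
def firstSpan (φ : OrthonormalBasis (Fin N) ℂ (Hilb n d)) (i : Fin N) :
    Submodule ℂ (Hilb n d) :=
  Submodule.span ℂ (Set.range fun j : Fin (i + 1) => φ (Fin.castLE i.2 j))

lemma finrank_firstSpan (φ : OrthonormalBasis (Fin N) ℂ (Hilb n d)) (i : Fin N) :
    Module.finrank ℂ (firstSpan φ i) = i + 1 := by
  have h : LinearIndependent ℂ fun j : Fin (i + 1) => φ (Fin.castLE i.2 j) :=
    φ.orthonormal.linearIndependent.comp _ (Fin.castLE_injective i.2)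
  rw [firstSpan, finrank_span_eq_card h, Fintype.card_fin]

lemma mem_firstSpan (φ : OrthonormalBasis (Fin N) ℂ (Hilb n d)) {i j : Fin N} (hj : j ≤ i) :
    φ j ∈ firstSpan φ i :=
  Submodule.subset_span ⟨⟨j, Nat.lt_succ_of_le hj⟩, rfl⟩

lemma inner_eq_zero_of_mem_firstSpan (φ : OrthonormalBasis (Fin N) ℂ (Hilb n d)) {i j : Fin N}
    (hj : i < j) {v : Hilb n d} (hv : v ∈ firstSpan φ i) : inner ℂ (φ j) v = 0 := by
  induction hv using Submodule.span_induction with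
  | mem u hu =>
    obtain ⟨k, rfl⟩ := hu
    refine φ.orthonormal.2 fun hk => ?_
    have h1 := k.2
    have h2 : (j : ℕ) = k := congrArg Fin.val hk
    have h3 : (i : ℕ) < j := hj
    omega
  | zero => simp
  | add x y _ _ hx hy => rw [inner_add_right, hx, hy, add_zero]
  | smul a x _ hx => rw [inner_smul_right, hx, mul_zero]

lemma IsEigensystem.re_inner_le_of_mem {A : Op n d} {E : Fin N → ℝ}
    {φ : OrthonormalBasis (Fin N) ℂ (Hilb n d)} (h : IsEigensystem A E φ) (i : Fin N)
    {v : Hilb n d} (hv : v ∈ firstSpan φ i) : (inner ℂ v (A v)).re ≤ E i * ‖v‖ ^ 2 := by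
  rw [re_inner_apply_of_diagonal φ h.2, ← φ.sum_sq_norm_inner_right, Finset.mul_sum]
  refine Finset.sum_le_sum fun j _ => ?_
  rcases le_or_gt j i with hj | hj
  · exact mul_le_mul_of_nonneg_right (h.1 hj) (by positivity)
  · simp [inner_eq_zero_of_mem_firstSpan φ hj hv]

/-- Eigenvalues are monotone, up to `η`, under a comparison of forms on the first eigenvectors. -/
lemma IsEigensystem.eigenvalue_le {A A' : Op n d} {E E' : Fin N → ℝ}
    {ψ φ : OrthonormalBasis (Fin N) ℂ (Hilb n d)} (h : IsEigensystem A E ψ)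
    (h' : IsEigensystem A' E' φ) (i : Fin N) (η : ℝ)
    (hη : ∀ v ∈ firstSpan φ i, (inner ℂ v (A v)).re ≤ (inner ℂ v (A' v)).re + η * ‖v‖ ^ 2) :
    E i ≤ E' i + η := by
  refine h.le_of_forall_mem i (firstSpan φ i) (by rw [finrank_firstSpan]; omega) _ fun v hv => ?_
  have h1 := h'.re_inner_le_of_mem i hv
  linarith [hη v hv]

/-- The images F φ_j need not be orthogonal; Cauchy–Schwarz costs the factor i + 1. -/
lemma norm_apply_sq_le_of_mem_firstSpan (φ : OrthonormalBasis (Fin N) ℂ (Hilb n d)) (i : Fin N)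
    (F : Op n d) {K : ℝ} (hK : ∀ j ≤ i, ‖F (φ j)‖ ^ 2 ≤ K) {v : Hilb n d}
    (hv : v ∈ firstSpan φ i) : ‖F v‖ ^ 2 ≤ (i + 1) * K * ‖v‖ ^ 2 := by
  have hsum : F v = ∑ j ∈ Finset.Iic i, inner ℂ (φ j) v • F (φ j) := by
    conv_lhs => rw [← φ.sum_repr' v, map_sum]
    simp only [map_smul]
    symm
    refine Finset.sum_subset (Finset.subset_univ _) fun j _ hj => ?_
    rw [inner_eq_zero_of_mem_firstSpan φ (by simpa using hj) hv, zero_smul]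
  have h1 : ‖F v‖ ≤ ∑ j ∈ Finset.Iic i, ‖inner ℂ (φ j) v‖ * ‖F (φ j)‖ := by
    rw [hsum]
    exact (norm_sum_le _ _).trans_eq (Finset.sum_congr rfl fun j _ => norm_smul _ _)
  calc ‖F v‖ ^ 2 ≤ (∑ j ∈ Finset.Iic i, ‖inner ℂ (φ j) v‖ * ‖F (φ j)‖) ^ 2 := by gcongr
    _ ≤ (Finset.Iic i).card * ∑ j ∈ Finset.Iic i, (‖inner ℂ (φ j) v‖ * ‖F (φ j)‖) ^ 2 :=
        sq_sum_le_card_mul_sum_sq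
    _ ≤ (i + 1) * ∑ j ∈ Finset.Iic i, ‖inner ℂ (φ j) v‖ ^ 2 * K := by
        rw [Fin.card_Iic]
        push_cast
        gcongr with j hj
        rw [mul_pow]
        gcongr
        exact hK j (Finset.mem_Iic.1 hj)
    _ ≤ (i + 1) * (‖v‖ ^ 2 * K) := by
        have hK0 : 0 ≤ K := (sq_nonneg _).trans (hK i le_rfl)
        rw [← Finset.sum_mul, ← φ.sum_sq_norm_inner_right v]
        gcongr
        exact Finset.subset_univ _
    _ = _ := by ring

/-- Normalise p: the squared distance is 2(1 - ‖p‖) ≤ 2(1 - ‖p‖²) = 2‖φ - p‖². -/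
lemma exists_unit_near {V : Type*} [NormedAddCommGroup V] [InnerProductSpace ℂ V]
    (K : Submodule ℂ V) {φ p : V} (hφ : ‖φ‖ = 1) (hp : p ∈ K) (hort : inner ℂ p (φ - p) = 0)
    {q : ℝ} (hq : ‖φ - p‖ ^ 2 ≤ q) (hq1 : q < 1) :
    ∃ g ∈ K, ‖g‖ = 1 ∧ ‖g - φ‖ ^ 2 ≤ 2 * q := by
  have hpyth : ‖p‖ ^ 2 + ‖φ - p‖ ^ 2 = 1 := by
    have h1 := norm_add_sq (𝕜 := ℂ) p (φ - p)
    rw [hort, add_sub_cancel, hφ] at h1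
    simp at h1
    linarith
  have hp0 : 0 < ‖p‖ := by
    by_contra! h0
    have : ‖p‖ = 0 := le_antisymm h0 (norm_nonneg _)
    rw [this] at hpyth
    linarith
  refine ⟨((‖p‖⁻¹ : ℝ) : ℂ) • p, K.smul_mem _ hp, ?_, ?_⟩
  · rw [norm_smul, Complex.norm_real, norm_inv, norm_norm, inv_mul_cancel₀ hp0.ne']
  · have hg : ‖((‖p‖⁻¹ : ℝ) : ℂ) • p‖ = 1 := by
      rw [norm_smul, Complex.norm_real, norm_inv, norm_norm, inv_mul_cancel₀ hp0.ne']
    have hin : (inner ℂ p φ).re = ‖p‖ ^ 2 := by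
      have h2 : (inner ℂ p p).re = ‖p‖ ^ 2 := inner_self_eq_norm_sq (𝕜 := ℂ) p
      rw [inner_sub_right, sub_eq_zero] at hort
      rw [hort, h2]
    have hin' : (inner ℂ (((‖p‖⁻¹ : ℝ) : ℂ) • p) φ).re = ‖p‖ := by
      rw [inner_smul_left, Complex.conj_ofReal, Complex.re_ofReal_mul, hin]
      field_simp
    have h1 := norm_sub_sq (𝕜 := ℂ) (((‖p‖⁻¹ : ℝ) : ℂ) • p) φ
    rw [hg, hφ] at h1
    change _ = 1 ^ 2 - 2 * (inner ℂ (((‖p‖⁻¹ : ℝ) : ℂ) • p) φ).re + 1 ^ 2 at h1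
    rw [hin'] at h1
    rw [h1]
    nlinarith [sq_nonneg ‖φ - p‖]

/-- A unit vector whose energy is within `η` of the ground energy is close to the ground space. -/
lemma IsEigensystem.exists_ground_near {A : Op n d} {E : Fin N → ℝ}
    {ψ : OrthonormalBasis (Fin N) ℂ (Hilb n d)} (h : IsEigensystem A E ψ) {f : ℕ} (hf : f < N)
    (hdeg : ∀ i : Fin N, (i : ℕ) < f → E i = E ⟨0, by omega⟩)
    (hgap : E ⟨0, by omega⟩ < E ⟨f, hf⟩) {φ : Hilb n d} (hφ : ‖φ‖ = 1) {q : ℝ} (hq1 : q < 1)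
    (hq : (inner ℂ φ (A φ)).re ≤ E ⟨0, by omega⟩ + (E ⟨f, hf⟩ - E ⟨0, by omega⟩) * q) :
    ∃ g ∈ groundSpace A, ‖g‖ = 1 ∧ ‖g - φ‖ ^ 2 ≤ 2 * q := by
  classical
  set p : Hilb n d := ∑ j with (j : Fin N).val < f, inner ℂ (ψ j) φ • ψ j with hp
  have hpc : ∀ i, inner ℂ (ψ i) p = if i.val < f then inner ℂ (ψ i) φ else 0 := fun i => by
    rw [hp, inner_sum]
    simp only [inner_smul_right, ψ.inner_eq_ite]
    simp
  have hpc' : ∀ i, inner ℂ (ψ i) (φ - p) = if i.val < f then 0 else inner ℂ (ψ i) φ := fun i => by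
    rw [inner_sub_right, hpc]
    split_ifs <;> simp
  refine exists_unit_near (groundSpace A) (p := p) hφ ?_ ?_ ?_ hq1
  · refine Submodule.sum_mem _ fun j hj => Submodule.smul_mem _ _ ?_
    rw [groundSpace, h.groundEnergy_eq (by omega), Module.End.mem_eigenspace_iff,
      ← hdeg j (Finset.mem_filter.1 hj).2]
    exact h.2 j
  · rw [← ψ.sum_inner_mul_inner]
    refine Finset.sum_eq_zero fun i _ => ?_
    rw [hpc', ← inner_conj_symm, hpc]
    split_ifs <;> simp
  · rw [re_inner_apply_of_diagonal ψ h.2] at hq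
    -- Every component outside the ground space costs at least the gap.
    have h1 : E ⟨0, by omega⟩ * ‖φ‖ ^ 2 + (E ⟨f, hf⟩ - E ⟨0, by omega⟩) * ‖φ - p‖ ^ 2 ≤
        ∑ i, E i * ‖inner ℂ (ψ i) φ‖ ^ 2 := by
      rw [← ψ.sum_sq_norm_inner_right φ, ← ψ.sum_sq_norm_inner_right (φ - p), Finset.mul_sum,
        Finset.mul_sum, ← Finset.sum_add_distrib]
      refine Finset.sum_le_sum fun i _ => ?_
      rw [hpc']
      split_ifs with hi
      · rw [hdeg i hi]; simp
      · have h2 : E ⟨f, hf⟩ ≤ E i := h.1 (Fin.mk_le_of_le_val (not_lt.1 hi))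
        nlinarith [sq_nonneg ‖inner ℂ (ψ i) φ‖]
    rw [hφ] at h1
    refine le_of_mul_le_mul_left ?_ (sub_pos.2 hgap)
    linarith

end Perturbation

/-! ### Comparison of H and H^(t) on low-energy states -/

section Tail

variable {n d : ℕ}

lemma hamiltonian_eq_truncatedHamiltonian_add (h : Interaction n d) (s : ℕ) (t : ℝ) :
    hamiltonian h s = truncatedHamiltonian h s t +
      ((leftPart h s - truncate (leftPart h s) t) +
        (rightPart h s - truncate (rightPart h s) t)) := by
  rw [hamiltonian, truncatedHamiltonian]
  abel

variable [Nontrivial (Hilb n d)] {h : Interaction n d}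

/-- Only the bond -s touches H_L; all the other terms are nonnegative, commute with H_L and go into
W. -/
lemma norm_exp_leftPart_sq_le (hh : h.IsNormalized) {s : ℕ} (hs1 : 1 ≤ s) (hs : s ≤ n)
    {t E τ : ℝ} (hE : E + 3 ≤ τ) (hτ : τ ≤ t) (hτ0 : 0 ≤ τ) {φ : Hilb n d} (hφ1 : ‖φ‖ = 1)
    (hφ : truncatedHamiltonian h s t φ = (E : ℂ) • φ) :
    ‖NormedSpace.exp ((1 / 4 : ℂ) • leftPart h s) φ‖ ^ 2 ≤ τ * Real.exp (τ / 2) := by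
  have hR := isPositive_rightPart hh s
  have hL := isPositive_leftPart hh s
  refine norm_exp_apply_sq_le hL
    (W := bondTerm h (rightCut hs) + middlePart h s + truncate (rightPart h s) t)
    (((isPositive_bondTerm hh _).add (isPositive_middlePart hh s)).add
      (isPositive_truncate hR (hτ0.trans hτ)))
    (((commute_leftPart_rightCut h hs1 hs).add_right (commute_leftPart_middlePart h s)).add_right
      (Commute.truncate_left (commute_leftPart_rightPart h hs1).symm hL.isSelfAdjoint t).symm)
    (norm_conj_leftCut_le hh hs) hE hτ hτ0 hφ1 ?_
  rw [← hφ, truncatedHamiltonian, centralPart_eq h hs1 hs]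
  congr 1
  abel

lemma norm_exp_rightPart_sq_le (hh : h.IsNormalized) {s : ℕ} (hs1 : 1 ≤ s) (hs : s ≤ n)
    {t E τ : ℝ} (hE : E + 3 ≤ τ) (hτ : τ ≤ t) (hτ0 : 0 ≤ τ) {φ : Hilb n d} (hφ1 : ‖φ‖ = 1)
    (hφ : truncatedHamiltonian h s t φ = (E : ℂ) • φ) :
    ‖NormedSpace.exp ((1 / 4 : ℂ) • rightPart h s) φ‖ ^ 2 ≤ τ * Real.exp (τ / 2) := by
  have hR := isPositive_rightPart hh s
  have hL := isPositive_leftPart hh s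
  refine norm_exp_apply_sq_le hR
    (W := truncate (leftPart h s) t + middlePart h s + bondTerm h (leftCut n s))
    (((isPositive_truncate hL (hτ0.trans hτ)).add (isPositive_middlePart hh s)).add
      (isPositive_bondTerm hh _))
    ((((Commute.truncate_left (commute_leftPart_rightPart h hs1) hR.isSelfAdjoint t).add_left
      (commute_middlePart_rightPart h s)).add_left (commute_leftCut_rightPart h hs1 hs)).symm)
    (norm_conj_rightCut_le hh hs) hE hτ hτ0 hφ1 ?_
  rw [← hφ, truncatedHamiltonian, centralPart_eq h hs1 hs]
  congr 1
  abel

lemma re_inner_truncatedHamiltonian_le (hh : h.IsNormalized) (s : ℕ) (t : ℝ) (v : Hilb n d) :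
    (inner ℂ v (truncatedHamiltonian h s t v)).re ≤ (inner ℂ v (hamiltonian h s v)).re := by
  have h1 : 0 ≤ (inner ℂ v ((leftPart h s - truncate (leftPart h s) t) v)).re :=
    (isPositive_sub_truncate (isPositive_leftPart hh s) t).re_inner_nonneg_right v
  have h2 : 0 ≤ (inner ℂ v ((rightPart h s - truncate (rightPart h s) t) v)).re :=
    (isPositive_sub_truncate (isPositive_rightPart hh s) t).re_inner_nonneg_right v
  rw [hamiltonian_eq_truncatedHamiltonian_add h s t, add_apply, inner_add_right,
    add_apply (leftPart h s - _), inner_add_right, Complex.add_re, Complex.add_re]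
  linarith

/-- On the span of the first `i + 1` eigenvectors of the truncated Hamiltonian, the truncation
changes the energy by an exponentially small amount. -/
lemma re_inner_hamiltonian_le (hh : h.IsNormalized) {s : ℕ} (hs1 : 1 ≤ s) (hs : s ≤ n) {N : ℕ}
    {t τ : ℝ} {E' : Fin N → ℝ} {φ : OrthonormalBasis (Fin N) ℂ (Hilb n d)}
    (hφ : IsEigensystem (truncatedHamiltonian h s t) E' φ) (i : Fin N) (hE : E' i + 3 ≤ τ)
    (hτ : τ ≤ t) (hτ0 : 0 ≤ τ) {v : Hilb n d} (hv : v ∈ firstSpan φ i) :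
    (inner ℂ v (hamiltonian h s v)).re ≤ (inner ℂ v (truncatedHamiltonian h s t v)).re +
      4 * ((i : ℝ) + 1) * (τ * Real.exp (τ / 2)) * Real.exp (-(t / 2)) * ‖v‖ ^ 2 := by
  have hEj : ∀ j ≤ i, E' j + 3 ≤ τ := fun j hj => by linarith [hφ.1 hj]
  have h1 := norm_apply_sq_le_of_mem_firstSpan φ i _ (fun j hj =>
    norm_exp_leftPart_sq_le hh hs1 hs (hEj j hj) hτ hτ0 (φ.norm_eq_one j) (hφ.2 j)) hv
  have h2 := norm_apply_sq_le_of_mem_firstSpan φ i _ (fun j hj =>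
    norm_exp_rightPart_sq_le hh hs1 hs (hEj j hj) hτ hτ0 (φ.norm_eq_one j) (hφ.2 j)) hv
  have h3 := re_inner_sub_truncate_le (isPositive_leftPart hh s) t v
  have h4 := re_inner_sub_truncate_le (isPositive_rightPart hh s) t v
  have h5 := mul_le_mul_of_nonneg_left h1 (by positivity : 0 ≤ 2 * Real.exp (-(t / 2)))
  have h6 := mul_le_mul_of_nonneg_left h2 (by positivity : 0 ≤ 2 * Real.exp (-(t / 2)))
  rw [hamiltonian_eq_truncatedHamiltonian_add h s t, add_apply, inner_add_right,
    add_apply (leftPart h s - _), inner_add_right, Complex.add_re, Complex.add_re]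
  linarith

end Tail

/-- The freed spins in `excitation_le` need a second basis state; a space of dimension above 1
provides it. -/
lemma two_le_of_orthonormalBasis {n d N : ℕ} (hN : 1 < N)
    (ψ : OrthonormalBasis (Fin N) ℂ (Hilb n d)) : 2 ≤ d := by
  have h1 : Module.finrank ℂ (Hilb n d) = N := by
    rw [Module.finrank_eq_card_basis ψ.toBasis, Fintype.card_fin]
  rw [finrank_euclideanSpace, Fintype.card_fun, Fintype.card_fin, Fintype.card_fin] at h1
  by_contra! hd
  have : d ^ (2 * n + 1 + 1) ≤ 1 := Nat.pow_le_one_iff (by omega) |>.2 (by omega)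
  omega

end SpinChain

end

/-! ### Choice of constants and the three conclusions -/

theorem theorem2 (f : ℕ) (hf : 1 ≤ f) :
    ∃ C c : ℝ, 0 < C ∧ 0 < c ∧
      ∀ (n d s : ℕ), 1 ≤ s → s ≤ n →
      ∀ h : SpinChain.Interaction n d, SpinChain.Interaction.IsNormalized h →
      -- the spectrum of `H`, with an `f`-fold degenerate ground energy and gap `E f - E 0`
      ∀ (N : ℕ) (hN : f < N) (E : Fin N → ℝ)
        (ψ : OrthonormalBasis (Fin N) ℂ (SpinChain.Hilb n d)),
        SpinChain.IsEigensystem (SpinChain.hamiltonian h s) E ψ →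
        (∀ i : Fin N, (i : ℕ) < f → E i = E ⟨0, by omega⟩) →
        E ⟨0, by omega⟩ < E ⟨f, hN⟩ →
      ∀ t : ℝ, C ≤ t → C * Real.log (E ⟨f, hN⟩ - E ⟨0, by omega⟩)⁻¹ ≤ t →
      -- the spectrum of the truncated Hamiltonian
      ∀ (E' : Fin N → ℝ) (φ : OrthonormalBasis (Fin N) ℂ (SpinChain.Hilb n d)),
        SpinChain.IsEigensystem (SpinChain.truncatedHamiltonian h s t) E' φ →
        -- (a)
        (0 ≤ E ⟨0, by omega⟩ - E' ⟨f - 1, by omega⟩ ∧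
          (∀ i j : Fin N, i ≤ j → (j : ℕ) < f →
            E ⟨0, by omega⟩ - E' j ≤ E ⟨0, by omega⟩ - E' i) ∧
          E ⟨0, by omega⟩ - E' ⟨0, by omega⟩ ≤ (2 : ℝ) ^ (-(c * t))) ∧
        -- (b)
        (∀ i : Fin N, (i : ℕ) < f →
          ∃ g ∈ SpinChain.groundSpace (SpinChain.hamiltonian h s),
            ‖g‖ = 1 ∧ ‖g - φ i‖ ^ 2 ≤ (2 : ℝ) ^ (-(c * t))) ∧
        -- (c)
        (E ⟨f, hN⟩ - E ⟨0, by omega⟩) / 10 ≤ E' ⟨f, hN⟩ - E' ⟨0, by omega⟩ := by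

  set K : ℝ := 4 * ((f : ℝ) + 1) * (((f : ℝ) + 6) * Real.exp (((f : ℝ) + 6) / 2)) with hK
  have hf0 : (0 : ℝ) ≤ f := Nat.cast_nonneg f
  have hK1 : 1 ≤ K := by
    have h1 : 1 ≤ Real.exp (((f : ℝ) + 6) / 2) := Real.one_le_exp (by positivity)
    have h2 : 1 ≤ ((f : ℝ) + 6) * Real.exp (((f : ℝ) + 6) / 2) := by nlinarith
    rw [hK]
    nlinarith
  have hlog : 0 ≤ Real.log (2 * K) := Real.log_nonneg (by linarith)
  -- The three summands give exp(-t/8) ≤ ε, τ = f + 6 ≤ t and 2K ≤ exp(t/8). Of the decay exp(-t/2),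
  -- one eighth pays for ε and one for 2K, which leaves exp(-t/4).
  refine ⟨8 + (f + 6) + 8 * Real.log (2 * K), 1 / 4, by positivity, by norm_num, ?_⟩
  intro n d s hs1 hs h hh N hN E ψ hψ hdeg hgap t ht hlogt E' φ hφ
  have hd : 2 ≤ d := SpinChain.two_le_of_orthonormalBasis (by omega) ψ
  have : Nontrivial (SpinChain.Hilb n d) :=
    ⟨ψ ⟨0, by omega⟩, 0, by simpa using ψ.toBasis.ne_zero ⟨0, by omega⟩⟩
  set ε := E ⟨f, hN⟩ - E ⟨0, by omega⟩ with hε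
  have hε0 : 0 < ε := sub_pos.2 hgap
  set η := K * Real.exp (-(t / 2)) with hη
  have ht0 : 0 < t := by linarith
  have hεt : Real.exp (-(t / 8)) ≤ ε := by
    rw [← Real.le_log_iff_exp_le hε0]
    rw [Real.log_inv] at hlogt
    by_contra! hlt
    nlinarith
  have hKt : 2 * K ≤ Real.exp (t / 8) := by
    rw [← Real.log_le_iff_le_exp (by linarith)]
    linarith
  have hη2 : 2 * η ≤ ε * Real.exp (-(t / 4)) := by
    calc 2 * η = 2 * K * Real.exp (-(t / 2)) := by rw [hη]; ring
      _ ≤ Real.exp (t / 8) * Real.exp (-(t / 2)) := by gcongr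
      _ = Real.exp (-(t / 8)) * Real.exp (-(t / 4)) := by
          rw [← Real.exp_add, ← Real.exp_add]; congr 1; ring
      _ ≤ _ := by gcongr
  have hη1 : η ≤ Real.exp (-(t / 4)) := by
    calc η ≤ 2 * K * Real.exp (-(t / 2)) := by
          rw [hη]; gcongr; linarith
      _ ≤ Real.exp (t / 8) * Real.exp (-(t / 2)) := by gcongr
      _ ≤ _ := by rw [← Real.exp_add]; gcongr; linarith
  have hpow : Real.exp (-(t / 4)) ≤ (2 : ℝ) ^ (-(1 / 4 * t)) := by
    rw [Real.rpow_def_of_pos two_pos]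
    gcongr
    nlinarith [Real.log_two_lt_d9]
  have hexp1 : Real.exp (-(t / 4)) ≤ 1 := Real.exp_le_one_iff.2 (by linarith)
  have hWeyl : ∀ i, E' i ≤ E i := fun i => by
    simpa using hφ.eigenvalue_le hψ i 0 fun v _ => by
      simpa using SpinChain.re_inner_truncatedHamiltonian_le hh s t v
  have hE0 : E ⟨0, by omega⟩ ≤ 2 := SpinChain.groundEnergy_le_two hh hs1 hs (by omega) hψ
  have hEf := SpinChain.excitation_le hh hs1 hs hd hN hψ
  -- The level τ = f + 6 works because E'_f ≤ E_f ≤ 2 + (f + 1). The f-th eigenvector is included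
  -- for the sake of (c).
  have hform : ∀ v ∈ SpinChain.firstSpan φ ⟨f, hN⟩,
      (inner ℂ v (SpinChain.hamiltonian h s v)).re ≤
        (inner ℂ v (SpinChain.truncatedHamiltonian h s t v)).re + η * ‖v‖ ^ 2 := fun v hv =>
    SpinChain.re_inner_hamiltonian_le hh hs1 hs hφ ⟨f, hN⟩ (τ := f + 6)
      (by linarith [hWeyl ⟨f, hN⟩]) (by linarith) (by positivity) hv
  have hφform : ∀ i : Fin N, (i : ℕ) ≤ f →
      (inner ℂ (φ i) (SpinChain.hamiltonian h s (φ i))).re ≤ E' i + η := fun i hi => by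
    have h1 := hform (φ i) (SpinChain.mem_firstSpan φ hi)
    rw [SpinChain.re_inner_of_eigen (hφ.2 i), φ.norm_eq_one] at h1
    linarith
  refine ⟨⟨?_, ?_, ?_⟩, ?_, ?_⟩
  · rw [← hdeg ⟨f - 1, by omega⟩ (by simp only; omega)]
    exact sub_nonneg.2 (hWeyl _)
  · intro i j hij _
    linarith [hφ.1 hij]
  · have h1 := hψ.le_re_inner (by omega) (φ ⟨0, by omega⟩)
    rw [φ.norm_eq_one] at h1
    have h2 := hφform ⟨0, by omega⟩ (Nat.zero_le _)
    linarith
  · intro i hi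
    have h1 : η = ε * (η / ε) := by field_simp
    have h2 : 2 * (η / ε) ≤ Real.exp (-(t / 4)) := by
      rw [← mul_div_assoc, div_le_iff₀ hε0]
      linarith
    obtain ⟨g, hg, hg1, hgφ⟩ := hψ.exists_ground_near hN hdeg hgap (φ.norm_eq_one i)
      (q := η / ε) (by linarith) (by
        have h3 := hφform i hi.le
        have h4 := hWeyl i
        rw [hdeg i hi] at h4
        linarith)
    exact ⟨g, hg, hg1, by linarith⟩
  -- The gap shrinks by at most η ≤ ε/2, which is better than the factor 1/10 asked for.
  · have h1 := hψ.eigenvalue_le hφ ⟨f, hN⟩ η hform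
    have h2 := hWeyl ⟨0, by omega⟩
    have h3 : ε * Real.exp (-(t / 4)) ≤ ε := by nlinarith
    linarith
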